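/- For a finite Borel measure $\mu$ on $\mathbb{R}$ write $\widehat{\mu}(\xi)=\int e^{-2\pi i x\xi}\,d\mu(x)$, and for $A\subseteq\mathbb{R}$ let $\dim_H(A)$ be its Hausdorff dimension and let its Fourier dimension $\dim_F(A)$ be the supremum of all $s\in[0,1]$ such that $\sup_{\xi\in\mathbb{R}}|\widehat{\mu}(\xi)|^2|\xi|^s<\infty$ for some non-zero finite Borel measure $\mu$ on $\mathbb{R}$ with compact support contained in $A$. Let $Y, Z\subseteq\mathbb{R}$ be compact sets such that $Z$ is non-empty, $Y$ contains a non-zero point and $\dim_F(Y)+\dim_H(Z)>0$. Then for every $\alpha\in[0,1]$ with $\dim_F(Y)+\dim_H(Z)>1-\alpha$ there exists a compact set $R\subseteq(0,\infty)$ such that $\dim_H(R)=\dim_F(R)=\alpha$ and the set $RY+Z=\{ry+z : r\in R,\ y\in Y,\ z\in Z\}$ has positive Lebesgue measure. -/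

import Mathlib

open MeasureTheory Set
open scoped ENNReal NNReal Pointwise

/-- The Fourier transform `μ̂(ξ) = ∫ e^{-2πixξ} dμ(x)` of a (finite Borel) measure on `ℝ`. -/
noncomputable def measureFourier (μ : Measure ℝ) (ξ : ℝ) : ℂ :=
  ∫ x, Complex.exp (-2 * Real.pi * Complex.I * x * ξ) ∂μ

/-- `𝓜(A)`: the non-zero finite Borel measures on `ℝ` with compact support contained in `A`. -/
def compactlySupportedMeasures (A : Set ℝ) : Set (Measure ℝ) :=
  {μ | IsFiniteMeasure μ ∧ μ ≠ 0 ∧ IsCompact μ.support ∧ μ.support ⊆ A}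

/-- `sup_ξ |μ̂(ξ)|² |ξ|^s < ∞`. -/
def HasFourierDecay (μ : Measure ℝ) (s : ℝ) : Prop :=
  BddAbove (range fun ξ : ℝ => ‖measureFourier μ ξ‖ ^ 2 * |ξ| ^ s)

/-- The Fourier dimension of `A ⊆ ℝ`: the supremum of the `s ∈ [0, 1]` such that
`sup_ξ |μ̂(ξ)|² |ξ|^s < ∞` for some `μ ∈ 𝓜(A)`. It is `0` for the empty set. -/
noncomputable def fourierDim (A : Set ℝ) : ℝ≥0∞ :=
  ⨆ (s : ℝ≥0) (_ : s ≤ 1 ∧ ∃ μ ∈ compactlySupportedMeasures A, HasFourierDecay μ s), (s : ℝ≥0∞)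

/-! Only the self-correlation `(μ × μ) {|x - y| ≤ r}` of measures matters for the positivity of
Lebesgue measure. Fourier decay of order `s < 1` gives correlation `O(r ^ s)` by testing against a
Gaussian of width `r` (`HasFourierDecay.correlation_le`), and a closed set carries such measures for
every `0 < s < dimH` by Frostman's lemma (`hasCorrelation_of_lt_dimH`).

Let `C` be a Salem set of dimension `α` and choose measures on `C`, `Y`, `Z` with correlation
exponents of sum greater than `1`. Each exponent is either `0`, realised by a point mass, or
strictly below the corresponding dimension. The set `R` is an affine image `a + bC` with `a, b ∈ [1,
2]`. The difference of two values of `(a + bc)y + z` is `au + bv + w`, where `u = y - y'`, `v = cy -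
c'y'`, `w = z - z'`. Once `Y` is cut off from `0`, the maximum of `|u|, |v|, |w|` controls the
distance `D` between the two triples, so the parameters with `|au + bv + w| ≤ r` have measure `O(r /
D)`. Since the exponents add up to more than `1`, `1 / D` is integrable. By Fatou's lemma, for
almost every `(a, b)` the image measure has correlation `O(r)` along infinitely many dyadic scales,
and such a measure cannot live on a Lebesgue null set (`exists_affine_volume_pos`).

The Salem set for `0 < α < 1` consists of points of `[0, 2]` that are, for each of infinitely many
`M`, close to a fraction with prime denominator `p ≤ M` at precision `M ^ (1 - 2 / α) / p`. Covering
by these intervals bounds the Hausdorff dimension by `α`. For the Fourier side, a smooth density is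
multiplied repeatedly by averages over `p` of periodic tents: frequency `k` is hit only by the few
primes dividing `k`, so each step perturbs the transform very little, and a weak limit has decay of
every order below `α` (`exists_salem_measure`).

Affine maps preserve the Fourier bound and do not raise Hausdorff dimension, and
`fourierDim_le_dimH` closes the chain of inequalities `α ≤ fourierDim R ≤ dimH R ≤ α`. -/

/-- `A` carries a non-zero finite measure `μ` with `(μ × μ) {|x - y| ≤ r} = O(r ^ s)`. -/
def HasCorrelation (A : Set ℝ) (s : ℝ) : Prop :=
  ∃ μ : Measure ℝ, IsFiniteMeasure μ ∧ μ ≠ 0 ∧ μ Aᶜ = 0 ∧ ∃ C : ℝ, ∀ r : ℝ, 0 < r →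
    (μ.prod μ) {p | |p.1 - p.2| ≤ r} ≤ ENNReal.ofReal (C * r ^ s)

/-! ### Self-correlation and Lebesgue measure. -/

theorem measurableSet_abs_sub_le (r : ℝ) : MeasurableSet {p : ℝ × ℝ | |p.1 - p.2| ≤ r} :=
  measurableSet_le (by fun_prop) measurable_const

/-- A measure with small self-correlation at scale `r` cannot live on a set with a small
`r`-neighbourhood. -/
theorem sq_measure_univ_mul_le (σ : Measure ℝ) [IsFiniteMeasure σ] {K : Set ℝ} (hK : IsCompact K)
    (hσ : σ Kᶜ = 0) {r : ℝ} (hr : 0 < r) :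
    σ univ ^ 2 * ENNReal.ofReal r ≤
      volume (Metric.cthickening r K) * (σ.prod σ) {p | |p.1 - p.2| ≤ r} := by
  -- Cut the line into cells of length `r`. The cells meeting `K` lie in its `r`-neighbourhood,
  -- their squares lie in the strip around the diagonal, and Cauchy–Schwarz over these cells links
  -- the two.
  set f : ℝ → ℤ := fun x => ⌊x / r⌋ with hf
  have hfm : Measurable f := by fun_prop
  have hfb : (f '' K).Finite := by
    obtain ⟨M, hM⟩ := hK.isBounded.subset_closedBall 0
    refine (Set.finite_Icc ⌊-M / r⌋ ⌊M / r⌋).subset ?_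
    rintro _ ⟨x, hx, rfl⟩
    have := hM hx
    rw [Metric.mem_closedBall, Real.dist_eq, sub_zero, abs_le] at this
    exact ⟨Int.floor_mono (by gcongr; exact this.1), Int.floor_mono (by gcongr; exact this.2)⟩
  set S : Finset ℤ := hfb.toFinset with hS
  have hIm (i : ℤ) : MeasurableSet (f ⁻¹' {i}) := hfm (measurableSet_singleton i)
  have hI (i : ℤ) : f ⁻¹' {i} = Ico (i * r) ((i + 1) * r) := by
    ext x
    simp only [hf, mem_preimage, mem_singleton_iff, Int.floor_eq_iff, mem_Ico, le_div_iff₀ hr,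
      div_lt_iff₀ hr]
  have hdisj : (S : Set ℤ).PairwiseDisjoint (fun i => f ⁻¹' {i}) := by
    intro i _ j _ hij
    exact Disjoint.preimage f (by simpa using hij)
  have h1 : σ univ = ∑ i ∈ S, σ (f ⁻¹' {i}) := by
    rw [← measure_biUnion_finset hdisj (fun i _ => hIm i)]
    refine le_antisymm ?_ (measure_mono (subset_univ _))
    calc σ univ ≤ σ ((⋃ i ∈ S, f ⁻¹' {i}) ∪ Kᶜ) := by
          refine measure_mono fun x _ => ?_
          by_cases hx : x ∈ K
          · left
            simp only [mem_iUnion]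
            exact ⟨f x, by simpa [hS] using ⟨x, hx, rfl⟩, rfl⟩
          · exact Or.inr hx
      _ ≤ _ := (measure_union_le _ _).trans (by rw [hσ, add_zero])
  have h2 : ∑ i ∈ S, σ (f ⁻¹' {i}) ^ 2 ≤ (σ.prod σ) {p | |p.1 - p.2| ≤ r} := by
    have : ∀ i ∈ S, σ (f ⁻¹' {i}) ^ 2 = (σ.prod σ) ((f ⁻¹' {i}) ×ˢ (f ⁻¹' {i})) := by
      intro i _; rw [Measure.prod_prod, sq]
    rw [Finset.sum_congr rfl this, ← measure_biUnion_finset]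
    · refine measure_mono ?_
      simp only [iUnion_subset_iff]
      rintro i _ ⟨x, y⟩ ⟨hx, hy⟩
      simp only [hI, mem_Ico] at hx hy
      simp only [mem_ofPred_eq, abs_le]
      constructor <;> nlinarith [hx.1, hx.2, hy.1, hy.2]
    · intro i hi j hj hij
      exact Disjoint.set_prod_left (hdisj hi hj hij) _ _
    · exact fun i _ => (hIm i).prod (hIm i)
  have h3 : (S.card : ℝ≥0∞) * ENNReal.ofReal r ≤ volume (Metric.cthickening r K) := by
    have : (S.card : ℝ≥0∞) * ENNReal.ofReal r = ∑ i ∈ S, volume (f ⁻¹' {i}) := by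
      simp only [hI, Real.volume_Ico]
      rw [Finset.sum_congr rfl (g := fun _ => ENNReal.ofReal r) (fun i _ => by congr 1; ring)]
      simp
    rw [this, ← measure_biUnion_finset hdisj (fun i _ => hIm i)]
    refine measure_mono ?_
    simp only [iUnion_subset_iff]
    intro i hi x hx
    obtain ⟨y, hy, hyi⟩ : i ∈ f '' K := by simpa [hS] using hi
    refine Metric.mem_cthickening_of_dist_le x y r K hy ?_
    have hy' : y ∈ f ⁻¹' {i} := hyi
    simp only [hI, mem_Ico] at hx hy'
    rw [Real.dist_eq, abs_le]
    constructor <;> nlinarith [hx.1, hx.2, hy'.1, hy'.2]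
  have h4 : (∑ i ∈ S, σ (f ⁻¹' {i})) ^ 2 ≤ S.card * ∑ i ∈ S, σ (f ⁻¹' {i}) ^ 2 := by
    have hfin (i : ℤ) : σ (f ⁻¹' {i}) = ((σ (f ⁻¹' {i})).toNNReal : ℝ≥0∞) :=
      (ENNReal.coe_toNNReal (measure_ne_top _ _)).symm
    rw [Finset.sum_congr rfl (fun i _ => hfin i),
      Finset.sum_congr rfl (fun i _ => congrArg (· ^ 2) (hfin i))]
    have := sq_sum_le_card_mul_sum_sq (s := S) (f := fun i => (σ (f ⁻¹' {i})).toNNReal)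
    exact_mod_cast this
  calc σ univ ^ 2 * ENNReal.ofReal r
      ≤ (S.card * ∑ i ∈ S, σ (f ⁻¹' {i}) ^ 2) * ENNReal.ofReal r := by rw [h1]; gcongr
    _ = (S.card * ENNReal.ofReal r) * ∑ i ∈ S, σ (f ⁻¹' {i}) ^ 2 := by ring
    _ ≤ _ := by gcongr

/-- The volume of the `r`-neighbourhood of a compact set tends to the volume of the set, so a bound
along any sequence of scales, even only infinitely often, yields `σ univ ^ 2 ≤ volume K * C` in the
limit. -/
theorem volume_pos_of_frequently_correlation_le (σ : Measure ℝ) [IsFiniteMeasure σ] (hσ0 : σ ≠ 0)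
    {K : Set ℝ} (hK : IsCompact K) (hσ : σ Kᶜ = 0) {C : ℝ≥0∞} (hC : C ≠ ∞) {r : ℕ → ℝ}
    (hr : ∀ n, 0 < r n) (hr0 : Filter.Tendsto r Filter.atTop (nhds 0))
    (h : ∃ᶠ n in Filter.atTop, (σ.prod σ) {p | |p.1 - p.2| ≤ r n} ≤ C * ENNReal.ofReal (r n)) :
    0 < volume K := by
  have hlim : Filter.Tendsto (fun n => volume (Metric.cthickening (r n) K) * C) Filter.atTop
      (nhds (volume K * C)) :=
    ENNReal.Tendsto.mul_const ((tendsto_measure_cthickening_of_isCompact hK).comp hr0)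
      (Or.inr hC)
  have hle : σ univ ^ 2 ≤ volume K * C := by
    refine ge_of_tendsto_of_frequently hlim (h.mono fun n hn => ?_)
    have h0 : ENNReal.ofReal (r n) ≠ 0 := by simpa using hr n
    have := (sq_measure_univ_mul_le σ hK hσ (hr n)).trans (mul_le_mul_right hn _)
    rw [← mul_assoc] at this
    exact (ENNReal.mul_le_mul_iff_left h0 ENNReal.ofReal_ne_top).1 this
  rw [pos_iff_ne_zero]
  intro h0
  rw [h0, zero_mul, nonpos_iff_eq_zero] at hle
  simp [hσ0] at hle

/-! ### Transversality of the affine family. -/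

/-- The solution set is an interval of radius `r / |u|`; the multiplied form keeps `u = 0` harmless.
-/
theorem volume_abs_mul_add_le_mul (u κ : ℝ) {r : ℝ} :
    volume {a : ℝ | |a * u + κ| ≤ r} * ENNReal.ofReal |u| ≤ ENNReal.ofReal (2 * r) := by
  rcases eq_or_ne u 0 with rfl | hu
  · simp
  have hu' : 0 < |u| := abs_pos.2 hu
  have : {a : ℝ | |a * u + κ| ≤ r} ⊆ Metric.closedBall (-κ / u) (r / |u|) := by
    intro a ha
    rw [mem_ofPred_eq] at ha
    rw [Metric.mem_closedBall, Real.dist_eq, le_div_iff₀ hu', ← abs_mul]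
    have h : (a - -κ / u) * u = a * u + κ := by
      rw [sub_mul, div_mul_cancel₀ _ hu]
      ring
    rwa [h]
  calc _ ≤ volume (Metric.closedBall (-κ / u) (r / |u|)) * ENNReal.ofReal |u| := by gcongr
    _ = ENNReal.ofReal (2 * r) := by
      rw [Real.volume_closedBall, ← ENNReal.ofReal_mul' hu'.le]
      congr 1
      field_simp

/-- Lebesgue measure on the square `[1, 2]²` of parameters. -/
noncomputable def paramMeasure : Measure (ℝ × ℝ) :=
  (volume.restrict (Icc 1 2)).prod (volume.restrict (Icc 1 2))

instance : IsProbabilityMeasure (volume.restrict (Icc (1 : ℝ) 2)) :=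
  ⟨by norm_num [Real.volume_Icc]⟩

instance : IsProbabilityMeasure paramMeasure := by unfold paramMeasure; infer_instance

theorem paramMeasure_ae : ∀ᵐ θ ∂paramMeasure, θ.1 ∈ Icc (1 : ℝ) 2 ∧ θ.2 ∈ Icc (1 : ℝ) 2 := by
  have : ∀ᵐ a ∂(volume.restrict (Icc (1 : ℝ) 2)), a ∈ Icc (1 : ℝ) 2 :=
    ae_restrict_mem measurableSet_Icc
  exact (Measure.quasiMeasurePreserving_fst.ae this).and
    (Measure.quasiMeasurePreserving_snd.ae this)

theorem measurableSet_strip (u v w r : ℝ) :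
    MeasurableSet {θ : ℝ × ℝ | |θ.1 * u + θ.2 * v + w| ≤ r} :=
  measurableSet_le (by fun_prop) measurable_const

theorem paramMeasure_strip_mul_fst_le (u v w r : ℝ) :
    paramMeasure {θ | |θ.1 * u + θ.2 * v + w| ≤ r} * ENNReal.ofReal |u| ≤
      ENNReal.ofReal (2 * r) := by
  rw [paramMeasure, Measure.prod_apply_symm (measurableSet_strip u v w r),
    ← lintegral_mul_const' _ _ ENNReal.ofReal_ne_top]
  calc _ ≤ ∫⁻ _ : ℝ, ENNReal.ofReal (2 * r) ∂(volume.restrict (Icc (1 : ℝ) 2)) := by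
        refine lintegral_mono fun b => ?_
        refine le_trans ?_ (volume_abs_mul_add_le_mul u (b * v + w))
        refine mul_le_mul_left ?_ _
        refine (Measure.restrict_apply_le _ _).trans (measure_mono ?_)
        intro a ha
        simpa [add_assoc] using ha
    _ = _ := by simp

theorem paramMeasure_strip_mul_snd_le (u v w r : ℝ) :
    paramMeasure {θ | |θ.1 * u + θ.2 * v + w| ≤ r} * ENNReal.ofReal |v| ≤
      ENNReal.ofReal (2 * r) := by
  rw [paramMeasure, Measure.prod_apply (measurableSet_strip u v w r),
    ← lintegral_mul_const' _ _ ENNReal.ofReal_ne_top]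
  calc _ ≤ ∫⁻ _ : ℝ, ENNReal.ofReal (2 * r) ∂(volume.restrict (Icc (1 : ℝ) 2)) := by
        refine lintegral_mono fun a => ?_
        refine le_trans ?_ (volume_abs_mul_add_le_mul v (a * u + w))
        refine mul_le_mul_left ?_ _
        refine (Measure.restrict_apply_le _ _).trans (measure_mono ?_)
        intro b hb
        rw [mem_ofPred_eq]
        rw [mem_preimage, mem_ofPred_eq] at hb
        convert hb using 2
        ring
    _ = _ := by simp

/-- Transversality: for most parameters `(a, b)` the number `a u + b v + w` is not small. -/
theorem paramMeasure_strip_mul_le {u v w r m : ℝ} (hr : 0 < r)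
    (hm : m ≤ max (max |u| |v|) |w|) :
    paramMeasure {θ | |θ.1 * u + θ.2 * v + w| ≤ r} * ENNReal.ofReal m ≤
      ENNReal.ofReal (16 * r) := by
  set P := paramMeasure {θ | |θ.1 * u + θ.2 * v + w| ≤ r} with hP
  have hu : P * ENNReal.ofReal |u| ≤ ENNReal.ofReal (2 * r) := paramMeasure_strip_mul_fst_le ..
  have hv : P * ENNReal.ofReal |v| ≤ ENNReal.ofReal (2 * r) := paramMeasure_strip_mul_snd_le ..
  have h2 : ENNReal.ofReal (2 * r) ≤ ENNReal.ofReal (16 * r) :=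
    ENNReal.ofReal_le_ofReal (by linarith)
  have hP1 : P ≤ 1 := prob_le_one
  by_cases hmu : m ≤ |u|
  · exact le_trans (by gcongr) (hu.trans h2)
  by_cases hmv : m ≤ |v|
  · exact le_trans (by gcongr) (hv.trans h2)
  by_cases hmr : m ≤ 16 * r
  · calc P * ENNReal.ofReal m ≤ 1 * ENNReal.ofReal (16 * r) := by gcongr
      _ = _ := one_mul _
  push Not at hmu hmv hmr
  have hw : m ≤ |w| := by
    rcases le_max_iff.1 hm with h | h
    · rcases le_max_iff.1 h with h | h <;> linarith
    · exact h
  by_cases hsm : m ≤ 8 * max |u| |v|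
  · calc P * ENNReal.ofReal m ≤ P * ENNReal.ofReal (8 * max |u| |v|) := by gcongr
      _ = 8 * (P * ENNReal.ofReal (max |u| |v|)) := by
        rw [ENNReal.ofReal_mul (by norm_num)]
        simp only [ENNReal.ofReal_ofNat]
        ring
      _ ≤ 8 * ENNReal.ofReal (2 * r) := by
        gcongr
        rcases max_choice |u| |v| with h | h <;> rw [h] <;> assumption
      _ = ENNReal.ofReal (16 * r) := by
        rw [show (8 : ℝ≥0∞) = ENNReal.ofReal 8 by simp, ← ENNReal.ofReal_mul (by norm_num)]
        congr 1
        ring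
  -- Here `|w| ≥ m` exceeds `8 * max |u| |v|`, while the parameters are at most `2`. The form thus
  -- has size at least `m / 2 > 8 * r`, so almost no parameter lies in the strip.
  push Not at hsm
  have hP0 : P = 0 := by
    rw [hP]
    refine measure_eq_zero_iff_ae_notMem.2 ?_
    filter_upwards [paramMeasure_ae] with θ hθ hmem
    have h1 : |θ.1 * u| ≤ 2 * max |u| |v| := by
      rw [abs_mul, abs_of_nonneg (by linarith [hθ.1.1])]
      gcongr
      · exact hθ.1.2
      · exact le_max_left _ _
    have h2 : |θ.2 * v| ≤ 2 * max |u| |v| := by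
      rw [abs_mul, abs_of_nonneg (by linarith [hθ.2.1])]
      gcongr
      · exact hθ.2.2
      · exact le_max_right _ _
    have h3 : |w| ≤ |θ.1 * u + θ.2 * v + w| + |θ.1 * u| + |θ.2 * v| := by
      calc |w| = |(θ.1 * u + θ.2 * v + w) - θ.1 * u - θ.2 * v| := by congr 1; ring
        _ ≤ _ := (abs_sub _ _).trans (by gcongr; exact abs_sub _ _)
    linarith
  rw [hP0, zero_mul]
  exact zero_le

/-! ### Energy integrals and averaging over the parameters. -/

theorem prod_prod_setOf_fst_snd {X Y : Type*} [MeasurableSpace X] [MeasurableSpace Y]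
    (μ : Measure X) (ν : Measure Y) [SFinite μ] [SFinite ν] {S : Set (X × X)} {T : Set (Y × Y)}
    (hS : MeasurableSet S) (hT : MeasurableSet T) :
    ((μ.prod ν).prod (μ.prod ν)) {q | (q.1.1, q.2.1) ∈ S ∧ (q.1.2, q.2.2) ∈ T} =
      (μ.prod μ) S * (ν.prod ν) T := by
  have hm : MeasurableSet {q : (X × Y) × (X × Y) | (q.1.1, q.2.1) ∈ S ∧ (q.1.2, q.2.2) ∈ T} := by
    apply MeasurableSet.inter
    · exact hS.preimage (f := fun q : (X × Y) × (X × Y) => (q.1.1, q.2.1)) (by fun_prop)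
    · exact hT.preimage (f := fun q : (X × Y) × (X × Y) => (q.1.2, q.2.2)) (by fun_prop)
  rw [Measure.prod_apply hm, Measure.prod_apply hS, Measure.prod_apply hT,
    ← lintegral_prod_mul (measurable_measure_prodMk_left hS).aemeasurable
      (measurable_measure_prodMk_left hT).aemeasurable]
  refine lintegral_congr fun p => ?_
  rw [← Measure.prod_prod]
  rfl

/-- If `D` lies in `((1/2)^(k+1), (1/2)^k]`, the `k`-th term alone dominates `1 / D`. For `D ≤ 0`
every indicator is on and both sides are infinite. -/
theorem inv_ofReal_le_one_add_tsum (D : ℝ) :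
    (ENNReal.ofReal D)⁻¹ ≤
      1 + ∑' k : ℕ, {x : ℝ | x ≤ (1 / 2) ^ k}.indicator (fun _ => (2 : ℝ≥0∞) ^ (k + 1)) D := by
  rcases le_or_gt D 0 with hD | hD
  · have : (∑' k : ℕ, {x : ℝ | x ≤ (1 / 2) ^ k}.indicator (fun _ => (2 : ℝ≥0∞) ^ (k + 1)) D) =
        ∞ := by
      refine top_unique ?_
      rw [← ENNReal.tsum_const_eq_top_of_ne_zero (α := ℕ) one_ne_zero]
      refine ENNReal.tsum_le_tsum fun k => ?_
      rw [indicator_of_mem]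
      · exact one_le_pow₀ one_le_two
      · exact hD.trans (by positivity)
    rw [this]
    simp
  rcases le_or_gt 1 D with h1 | h1
  · refine le_add_right ?_
    rw [ENNReal.inv_le_one, ENNReal.one_le_ofReal]
    exact h1
  obtain ⟨k, hk1, hk2⟩ := exists_nat_pow_near_of_lt_one hD h1.le (by norm_num : (0 : ℝ) < 1 / 2)
    (by norm_num)
  refine le_add_left (le_trans ?_ (ENNReal.le_tsum k))
  rw [indicator_of_mem (show D ∈ {x : ℝ | x ≤ (1 / 2) ^ k} from hk2)]
  rw [ENNReal.inv_le_iff_inv_le, ENNReal.inv_pow]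
  rw [show (2 : ℝ≥0∞)⁻¹ = ENNReal.ofReal (1 / 2) by
    rw [one_div, ENNReal.ofReal_inv_of_pos two_pos, ENNReal.ofReal_ofNat],
    ← ENNReal.ofReal_pow (by norm_num)]
  exact ENNReal.ofReal_le_ofReal hk1.le

/-- Summing over dyadic shells gives a geometric series of ratio `2 ^ (1 - s)`, convergent exactly
because `s > 1`. -/
theorem lintegral_inv_ofReal_lt_top {X : Type*} [MeasurableSpace X] (Λ : Measure X)
    [IsFiniteMeasure Λ] {D : X → ℝ} (hD : Measurable D) {C s : ℝ} (hs : 1 < s)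
    (h : ∀ δ : ℝ, 0 < δ → Λ {x | D x ≤ δ} ≤ ENNReal.ofReal (C * δ ^ s)) :
    ∫⁻ x, (ENNReal.ofReal (D x))⁻¹ ∂Λ < ∞ := by
  have hm (k : ℕ) : MeasurableSet {x : ℝ | x ≤ (1 / 2) ^ k} := measurableSet_Iic
  calc ∫⁻ x, (ENNReal.ofReal (D x))⁻¹ ∂Λ
      ≤ ∫⁻ x, (1 + ∑' k : ℕ, {x : ℝ | x ≤ (1 / 2) ^ k}.indicator
          (fun _ => (2 : ℝ≥0∞) ^ (k + 1)) (D x)) ∂Λ :=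
        lintegral_mono fun x => inv_ofReal_le_one_add_tsum (D x)
    _ = Λ univ + ∑' k : ℕ, (2 : ℝ≥0∞) ^ (k + 1) * Λ {x | D x ≤ (1 / 2) ^ k} := by
        rw [lintegral_add_left measurable_const, lintegral_one, lintegral_tsum]
        · congr 2
          ext k
          exact lintegral_indicator_const (hD (hm k)) _
        · exact fun k => ((measurable_const.indicator (hm k)).comp hD).aemeasurable
    _ ≤ Λ univ + ∑' k : ℕ, ENNReal.ofReal (2 * |C| * (2 * (1 / 2) ^ s) ^ k) := by
        gcongr with k
        refine (mul_le_mul_right (h _ (by positivity)) _).trans ?_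
        rw [show (2 : ℝ≥0∞) ^ (k + 1) = ENNReal.ofReal (2 ^ (k + 1)) by
          rw [ENNReal.ofReal_pow two_pos.le, ENNReal.ofReal_ofNat],
          ← ENNReal.ofReal_mul (by positivity)]
        refine ENNReal.ofReal_le_ofReal ?_
        have : (((1 / 2 : ℝ)) ^ k) ^ s = ((1 / 2) ^ s) ^ k := by
          rw [← Real.rpow_natCast, ← Real.rpow_natCast, ← Real.rpow_mul (by norm_num),
            ← Real.rpow_mul (by norm_num), mul_comm]
        rw [this, mul_pow, pow_succ]
        have h2 : C ≤ |C| := le_abs_self C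
        have h3 : (0 : ℝ) ≤ 2 ^ k * ((1 / 2) ^ s) ^ k := by positivity
        nlinarith
    _ < ∞ := by
        refine ENNReal.add_lt_top.2 ⟨measure_lt_top _ _, ?_⟩
        rw [← ENNReal.ofReal_tsum_of_nonneg (fun k => by positivity)]
        · exact ENNReal.ofReal_lt_top
        · refine (summable_geometric_of_lt_one (by positivity) ?_).mul_left _
          calc 2 * (1 / 2 : ℝ) ^ s < 2 * (1 / 2) ^ (1 : ℝ) := by
                gcongr 2 * ?_
                exact Real.rpow_lt_rpow_of_exponent_gt (by norm_num) (by norm_num) hs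
            _ = 1 := by norm_num

/-- Fatou's lemma over the parameters: if the average over `θ` of the self-correlation at scale `r`
of the image of `P` under `T θ` is `O(r)`, then almost every image charges only sets of positive
Lebesgue measure. -/
theorem ae_frequently_correlation_le {X : Type*} [MeasurableSpace X] (P : Measure X)
    [IsFiniteMeasure P] (Q : Measure (ℝ × ℝ)) [IsFiniteMeasure Q] {T : ℝ × ℝ → X → ℝ}
    (hT : Measurable (Function.uncurry T)) {I : ℝ≥0∞} (hI : I ≠ ∞)
    (h : ∀ r : ℝ, 0 < r → ∫⁻ p, Q {θ | |T θ p.1 - T θ p.2| ≤ r} ∂(P.prod P) ≤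
      ENNReal.ofReal r * I) :
    ∀ᵐ θ ∂Q, ∃ C : ℝ≥0∞, C ≠ ∞ ∧ ∃ᶠ n : ℕ in Filter.atTop,
      (P.prod P) {p | |T θ p.1 - T θ p.2| ≤ (1 / 2) ^ n} ≤ C * ENNReal.ofReal ((1 / 2) ^ n) := by
  set E : ℝ → Set ((ℝ × ℝ) × (X × X)) := fun r => {q | |T q.1 q.2.1 - T q.1 q.2.2| ≤ r} with hE
  have hEm (r : ℝ) : MeasurableSet (E r) := by
    refine measurableSet_le (Measurable.abs (Measurable.sub ?_ ?_)) measurable_const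
    · exact hT.comp (f := fun q : (ℝ × ℝ) × (X × X) => (q.1, q.2.1)) (by fun_prop)
    · exact hT.comp (f := fun q : (ℝ × ℝ) × (X × X) => (q.1, q.2.2)) (by fun_prop)
  -- The correlation at scale `2⁻ⁿ` divided by that scale; Tonelli bounds its parameter average by
  -- `I`, uniformly in `n`.
  set Φ : ℕ → ℝ × ℝ → ℝ≥0∞ := fun n θ =>
    (P.prod P) {p | |T θ p.1 - T θ p.2| ≤ (1 / 2) ^ n} * (ENNReal.ofReal ((1 / 2) ^ n))⁻¹
  have hΦm (n : ℕ) : Measurable (Φ n) :=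
    (measurable_measure_prodMk_left (hEm ((1 / 2) ^ n))).mul_const _
  have h0 (n : ℕ) : ENNReal.ofReal ((1 / 2) ^ n) ≠ 0 := by simp
  have hΦ (n : ℕ) : ∫⁻ θ, Φ n θ ∂Q ≤ I := by
    rw [show ∫⁻ θ, Φ n θ ∂Q = (∫⁻ θ, (P.prod P) {p | |T θ p.1 - T θ p.2| ≤ (1 / 2) ^ n} ∂Q) *
      (ENNReal.ofReal ((1 / 2) ^ n))⁻¹ from
        lintegral_mul_const _ (measurable_measure_prodMk_left (hEm ((1 / 2) ^ n)))]
    have h1 : ∫⁻ θ, (P.prod P) {p | |T θ p.1 - T θ p.2| ≤ (1 / 2) ^ n} ∂Q =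
        ∫⁻ p, Q {θ | |T θ p.1 - T θ p.2| ≤ (1 / 2) ^ n} ∂(P.prod P) := by
      rw [show (∫⁻ θ, (P.prod P) {p | |T θ p.1 - T θ p.2| ≤ (1 / 2) ^ n} ∂Q) =
        (Q.prod (P.prod P)) (E ((1 / 2) ^ n)) from (Measure.prod_apply (hEm _)).symm,
        Measure.prod_apply_symm (hEm _)]
      rfl
    rw [h1]
    calc _ ≤ ENNReal.ofReal ((1 / 2) ^ n) * I * (ENNReal.ofReal ((1 / 2) ^ n))⁻¹ := by
          gcongr
          exact h _ (by positivity)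
      _ = I * (ENNReal.ofReal ((1 / 2) ^ n) * (ENNReal.ofReal ((1 / 2) ^ n))⁻¹) := by ring
      _ = I := by rw [ENNReal.mul_inv_cancel (h0 n) ENNReal.ofReal_ne_top, mul_one]
  have hlim : ∫⁻ θ, Filter.liminf (fun n => Φ n θ) Filter.atTop ∂Q ≤ I :=
    (lintegral_liminf_le hΦm).trans (Filter.liminf_le_of_frequently_le'
      (Filter.Frequently.of_forall hΦ))
  have hae := ae_lt_top (Measurable.liminf hΦm) (hlim.trans_lt hI.lt_top).ne
  filter_upwards [hae] with θ hθ
  obtain ⟨C, hC1, hC2⟩ := exists_between hθ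
  refine ⟨C, hC2.ne, (Filter.frequently_lt_of_liminf_lt (u := fun i => Φ i θ) (h := hC1)).mono
    fun n hn => ?_⟩
  have := mul_le_mul_left hn.le (ENNReal.ofReal ((1 / 2) ^ n))
  rwa [mul_assoc, ENNReal.inv_mul_cancel (h0 n) ENNReal.ofReal_ne_top, mul_one] at this

/-- If the correlation dimensions of `A`, `B`, `Z` add up to more than one, then `A` has an affine
image `A'` such that `A' * B + Z` has positive Lebesgue measure. -/
theorem exists_affine_volume_pos {A B Z : Set ℝ} (hA : IsCompact A) (hB : IsCompact B)
    (hZ : IsCompact Z) {m : ℝ} (hm : 0 < m) (hBm : ∀ y ∈ B, m ≤ |y|) {s₁ s₂ s₃ : ℝ}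
    (h₁ : HasCorrelation A s₁) (h₂ : HasCorrelation B s₂) (h₃ : HasCorrelation Z s₃)
    (hs : 1 < s₁ + s₂ + s₃) :
    ∃ a ∈ Icc (1 : ℝ) 2, ∃ b ∈ Icc (1 : ℝ) 2, 0 < volume ((fun c => a + b * c) '' A * B + Z) := by
  obtain ⟨ρ, hρf, hρ0, hρA, C₁, hC₁⟩ := h₁
  obtain ⟨μ, hμf, hμ0, hμB, C₂, hC₂⟩ := h₂
  obtain ⟨ν, hνf, hν0, hνZ, C₃, hC₃⟩ := h₃
  set P := ρ.prod (μ.prod ν) with hP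
  have hP0 : P ≠ 0 := by
    rw [← Measure.measure_univ_ne_zero, hP, ← univ_prod_univ, Measure.prod_prod, ← univ_prod_univ,
      Measure.prod_prod]
    simp [hρ0, hμ0, hν0]
  set T : ℝ × ℝ → ℝ × ℝ × ℝ → ℝ := fun θ p => (θ.1 + θ.2 * p.1) * p.2.1 + p.2.2 with hTdef
  have hT : Measurable (Function.uncurry T) := by
    simp only [hTdef, Function.uncurry_def]
    fun_prop
  have hPae : ∀ᵐ p ∂P, p.1 ∈ A ∧ p.2.1 ∈ B ∧ p.2.2 ∈ Z := by
    have hA' : ∀ᵐ x ∂ρ, x ∈ A := hρA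
    have hB' : ∀ᵐ x ∂μ, x ∈ B := hμB
    have hZ' : ∀ᵐ x ∂ν, x ∈ Z := hνZ
    refine (Measure.quasiMeasurePreserving_fst.ae hA').and ?_
    exact Measure.quasiMeasurePreserving_snd.ae
      ((Measure.quasiMeasurePreserving_fst.ae hB').and (Measure.quasiMeasurePreserving_snd.ae hZ'))
  set D : (ℝ × ℝ × ℝ) × (ℝ × ℝ × ℝ) → ℝ := fun q =>
    max |q.1.1 - q.2.1| (max |q.1.2.1 - q.2.2.1| |q.1.2.2 - q.2.2.2|) with hDdef
  have hD : Measurable D := by fun_prop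
  have hDle : ∀ δ : ℝ, 0 < δ → (P.prod P) {q | D q ≤ δ} ≤
      ENNReal.ofReal (|C₁| * |C₂| * |C₃| * δ ^ (s₁ + s₂ + s₃)) := by
    intro δ hδ
    have habs {τ : Measure ℝ} {C s : ℝ}
        (h : (τ.prod τ) {p | |p.1 - p.2| ≤ δ} ≤ ENNReal.ofReal (C * δ ^ s)) :
        (τ.prod τ) {p | |p.1 - p.2| ≤ δ} ≤ ENNReal.ofReal (|C| * δ ^ s) :=
      h.trans (ENNReal.ofReal_le_ofReal (by gcongr; exact le_abs_self C))
    have e1 : {q | D q ≤ δ} = {q | (q.1.1, q.2.1) ∈ {p : ℝ × ℝ | |p.1 - p.2| ≤ δ} ∧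
        (q.1.2, q.2.2) ∈ {r : (ℝ × ℝ) × (ℝ × ℝ) | (r.1.1, r.2.1) ∈ {p : ℝ × ℝ | |p.1 - p.2| ≤ δ} ∧
          (r.1.2, r.2.2) ∈ {p : ℝ × ℝ | |p.1 - p.2| ≤ δ}}} := by
      ext q
      simp [hDdef]
    have hms : MeasurableSet {r : (ℝ × ℝ) × (ℝ × ℝ) | (r.1.1, r.2.1) ∈
        {p : ℝ × ℝ | |p.1 - p.2| ≤ δ} ∧ (r.1.2, r.2.2) ∈ {p : ℝ × ℝ | |p.1 - p.2| ≤ δ}} := by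
      apply MeasurableSet.inter
      · exact (measurableSet_abs_sub_le δ).preimage
          (f := fun r : (ℝ × ℝ) × (ℝ × ℝ) => (r.1.1, r.2.1)) (by fun_prop)
      · exact (measurableSet_abs_sub_le δ).preimage
          (f := fun r : (ℝ × ℝ) × (ℝ × ℝ) => (r.1.2, r.2.2)) (by fun_prop)
    rw [e1, hP, prod_prod_setOf_fst_snd ρ (μ.prod ν) (measurableSet_abs_sub_le δ) hms,
      prod_prod_setOf_fst_snd μ ν (measurableSet_abs_sub_le δ) (measurableSet_abs_sub_le δ)]
    refine (mul_le_mul' (habs (hC₁ δ hδ)) (mul_le_mul' (habs (hC₂ δ hδ)) (habs (hC₃ δ hδ)))).trans ?_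
    rw [← ENNReal.ofReal_mul (by positivity), ← ENNReal.ofReal_mul (by positivity),
      Real.rpow_add hδ, Real.rpow_add hδ]
    refine ENNReal.ofReal_le_ofReal (le_of_eq (by ring))
  have hint := lintegral_inv_ofReal_lt_top (P.prod P) hD hs hDle
  obtain ⟨L, hL⟩ := hA.isBounded.subset_closedBall 0
  have hL' : ∀ c ∈ A, |c| ≤ L := fun c hc => by simpa using hL hc
  -- The coefficients of the linear form recover the distance of the triples: `(c - c') y' = (c y -
  -- c' y') - c (y - y')`, with `|y'| ≥ m` and `c` bounded.
  obtain ⟨κ, hκ, hκD⟩ : ∃ κ : ℝ, 0 < κ ∧ ∀ p q : ℝ × ℝ × ℝ, p.1 ∈ A → q.2.1 ∈ B →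
      D (p, q) ≤ κ * max (max |p.2.1 - q.2.1| |p.1 * p.2.1 - q.1 * q.2.1|) |p.2.2 - q.2.2| := by
    refine ⟨1 + (1 + |L|) / m, by positivity, fun p q hp hq => ?_⟩
    set M := max (max |p.2.1 - q.2.1| |p.1 * p.2.1 - q.1 * q.2.1|) |p.2.2 - q.2.2|
    have hu : |p.2.1 - q.2.1| ≤ M := (le_max_left _ _).trans (le_max_left _ _)
    have hv : |p.1 * p.2.1 - q.1 * q.2.1| ≤ M := (le_max_right _ _).trans (le_max_left _ _)
    have hw : |p.2.2 - q.2.2| ≤ M := le_max_right _ _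
    have hM : 0 ≤ M := (abs_nonneg _).trans hw
    have h1 : M ≤ (1 + (1 + |L|) / m) * M := le_mul_of_one_le_left hM (by
      have : 0 ≤ (1 + |L|) / m := by positivity
      linarith)
    refine max_le ?_ (max_le (hu.trans h1) (hw.trans h1))
    have h2 : |p.1 - q.1| * m ≤ (1 + |L|) * M := by
      calc |p.1 - q.1| * m ≤ |p.1 - q.1| * |q.2.1| := by gcongr; exact hBm _ hq
        _ = |(p.1 * p.2.1 - q.1 * q.2.1) - p.1 * (p.2.1 - q.2.1)| := by
          rw [← abs_mul]; congr 1; ring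
        _ ≤ |p.1 * p.2.1 - q.1 * q.2.1| + |p.1| * |p.2.1 - q.2.1| := by
          rw [← abs_mul]; exact abs_sub _ _
        _ ≤ M + |L| * M := by
          exact add_le_add hv (mul_le_mul ((hL' _ hp).trans (le_abs_self L)) hu (abs_nonneg _)
            (abs_nonneg _))
        _ = _ := by ring
    calc |p.1 - q.1| ≤ (1 + |L|) * M / m := (le_div_iff₀ hm).2 h2
      _ = (1 + |L|) / m * M := by ring
      _ ≤ (1 + (1 + |L|) / m) * M := by gcongr; linarith
  have havg : ∀ r : ℝ, 0 < r →
      ∫⁻ q, paramMeasure {θ | |T θ q.1 - T θ q.2| ≤ r} ∂(P.prod P) ≤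
        ENNReal.ofReal r * (ENNReal.ofReal (16 * κ) *
          ∫⁻ q, (ENNReal.ofReal (D q))⁻¹ ∂(P.prod P)) := by
    intro r hr
    rw [← mul_assoc, ← ENNReal.ofReal_mul hr.le,
      ← lintegral_const_mul' _ _ ENNReal.ofReal_ne_top]
    have hae1 : ∀ᵐ q ∂(P.prod P), q.1.1 ∈ A ∧ q.1.2.1 ∈ B ∧ q.1.2.2 ∈ Z :=
      Measure.quasiMeasurePreserving_fst.ae hPae
    have hae2 : ∀ᵐ q ∂(P.prod P), q.2.1 ∈ A ∧ q.2.2.1 ∈ B ∧ q.2.2.2 ∈ Z :=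
      Measure.quasiMeasurePreserving_snd.ae hPae
    refine lintegral_mono_ae ?_
    filter_upwards [hae1, hae2] with ⟨p, q⟩ hp hq
    have hset : {θ : ℝ × ℝ | |T θ p - T θ q| ≤ r} =
        {θ | |θ.1 * (p.2.1 - q.2.1) + θ.2 * (p.1 * p.2.1 - q.1 * q.2.1) + (p.2.2 - q.2.2)| ≤ r} := by
      ext θ
      simp only [hTdef, mem_ofPred_eq]
      rw [show (θ.1 + θ.2 * p.1) * p.2.1 + p.2.2 - ((θ.1 + θ.2 * q.1) * q.2.1 + q.2.2) =
        θ.1 * (p.2.1 - q.2.1) + θ.2 * (p.1 * p.2.1 - q.1 * q.2.1) + (p.2.2 - q.2.2) by ring]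
    have hDpq : D (p, q) / κ ≤
        max (max |p.2.1 - q.2.1| |p.1 * p.2.1 - q.1 * q.2.1|) |p.2.2 - q.2.2| := by
      rw [div_le_iff₀' hκ]
      exact hκD p q hp.1 hq.2.1
    have key := paramMeasure_strip_mul_le hr hDpq
    rw [← hset] at key
    rcases (show (0 : ℝ) ≤ D (p, q) from (abs_nonneg _).trans (le_max_left _ _)).eq_or_lt
      with h0 | h0
    -- When the triples coincide the right-hand side is infinite.
    · rw [← h0]
      have : ENNReal.ofReal (r * (16 * κ)) ≠ 0 := by
        rw [Ne, ENNReal.ofReal_eq_zero, not_le]; positivity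
      simp [ENNReal.mul_top this]
    · rw [← div_eq_mul_inv,
        ENNReal.le_div_iff_mul_le (Or.inl (by simpa using h0)) (Or.inl ENNReal.ofReal_ne_top)]
      calc _ = paramMeasure {θ | |T θ p - T θ q| ≤ r} * ENNReal.ofReal (D (p, q) / κ) *
            ENNReal.ofReal κ := by
            rw [mul_assoc, ← ENNReal.ofReal_mul' hκ.le, div_mul_cancel₀ _ hκ.ne']
        _ ≤ ENNReal.ofReal (16 * r) * ENNReal.ofReal κ := by gcongr
        _ = _ := by rw [← ENNReal.ofReal_mul' hκ.le]; congr 1; ring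
  have hfreq := ae_frequently_correlation_le P paramMeasure hT
    (ENNReal.mul_ne_top ENNReal.ofReal_ne_top hint.ne) havg
  obtain ⟨θ, ⟨C, hC, hθ⟩, hθ1, hθ2⟩ := (hfreq.and paramMeasure_ae).exists
  refine ⟨θ.1, hθ1, θ.2, hθ2, ?_⟩
  have hTθ : Measurable (T θ) := hT.comp (measurable_const.prodMk measurable_id)
  have hK : IsCompact ((fun c => θ.1 + θ.2 * c) '' A * B + Z) :=
    ((hA.image (by fun_prop)).mul hB).add hZ
  refine volume_pos_of_frequently_correlation_le (P.map (T θ)) ?_ hK ?_ hC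
    (r := fun n => (1 / 2) ^ n) (fun n => by positivity)
    (tendsto_pow_atTop_nhds_zero_of_lt_one (by norm_num) (by norm_num)) (hθ.mono fun n hn => ?_)
  · rwa [Ne, Measure.map_eq_zero_iff hTθ.aemeasurable]
  · rw [Measure.map_apply hTθ hK.measurableSet.compl]
    refine measure_eq_zero_iff_ae_notMem.2 ?_
    filter_upwards [hPae] with p hp hmem
    exact hmem (add_mem_add (mul_mem_mul (mem_image_of_mem _ hp.1) hp.2.1) hp.2.2)
  · rw [Measure.map_prod_map _ _ hTθ hTθ, Measure.map_apply (by fun_prop)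
      (measurableSet_abs_sub_le _)]
    exact hn

/-! ### From Fourier decay to correlation. -/

theorem integral_abs_rpow_mul_exp {s b : ℝ} (hs : s < 1) (hb : 0 < b) :
    Integrable (fun ξ : ℝ => |ξ| ^ (-s) * Real.exp (-b * |ξ| ^ (2 : ℝ))) ∧
    ∫ ξ : ℝ, |ξ| ^ (-s) * Real.exp (-b * |ξ| ^ (2 : ℝ)) =
      b ^ (-(1 - s) / 2) * Real.Gamma ((1 - s) / 2) := by
  have h := integral_comp_abs (f := fun x : ℝ => x ^ (-s) * Real.exp (-b * x ^ (2 : ℝ)))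
  rw [integral_rpow_mul_exp_neg_mul_rpow two_pos (by linarith) hb,
    show -s + 1 = 1 - s by ring] at h
  have h' : ∫ ξ : ℝ, |ξ| ^ (-s) * Real.exp (-b * |ξ| ^ (2 : ℝ)) =
      b ^ (-(1 - s) / 2) * Real.Gamma ((1 - s) / 2) := by
    rw [h]; ring
  refine ⟨?_, h'⟩
  -- A non-integrable function would have integral `0` by convention, whereas the computed value is
  -- positive.
  by_contra hni
  rw [integral_undef hni] at h'
  have : 0 < b ^ (-(1 - s) / 2) * Real.Gamma ((1 - s) / 2) :=
    mul_pos (Real.rpow_pos_of_pos hb _) (Real.Gamma_pos_of_pos (by linarith))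
  linarith

theorem integral_exp_mul_gaussian {r : ℝ} (hr : 0 < r) (x : ℝ) :
    ∫ ξ : ℝ, Complex.exp (-2 * Real.pi * Complex.I * x * ξ) *
      Complex.exp (-((Real.pi * r ^ 2 : ℝ) : ℂ) * ξ ^ 2) =
      ((r⁻¹ * Real.exp (-Real.pi * x ^ 2 / r ^ 2) : ℝ) : ℂ) := by
  have hb : 0 < (((Real.pi * r ^ 2 : ℝ) : ℂ)).re := by
    rw [Complex.ofReal_re]; positivity
  have h := fourierIntegral_gaussian hb (-2 * Real.pi * x : ℂ)
  convert h using 1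
  · congr 1
    ext ξ
    congr 2
    ring
  · have hpi : (Real.pi : ℂ) ≠ 0 := by exact_mod_cast Real.pi_ne_zero
    have hr' : (r : ℂ) ≠ 0 := by exact_mod_cast hr.ne'
    have h1 : ((Real.pi : ℂ) / ((Real.pi * r ^ 2 : ℝ) : ℂ)) ^ (1 / 2 : ℂ) = ((r⁻¹ : ℝ) : ℂ) := by
      have : (Real.pi : ℂ) / ((Real.pi * r ^ 2 : ℝ) : ℂ) = (((r⁻¹) ^ 2 : ℝ) : ℂ) := by
        push_cast; field_simp
      rw [this, show (1 / 2 : ℂ) = ((1 / 2 : ℝ) : ℂ) by push_cast; rfl,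
        ← Complex.ofReal_cpow (by positivity), ← Real.sqrt_eq_rpow, Real.sqrt_sq (by positivity)]
    rw [h1]
    push_cast
    congr 2
    field_simp
    ring

theorem norm_exp_measureFourier_kernel (x ξ : ℝ) :
    ‖Complex.exp (-2 * Real.pi * Complex.I * x * ξ)‖ = 1 := by
  rw [show (-2 * Real.pi * Complex.I * x * ξ : ℂ) = ((-2 * Real.pi * x * ξ : ℝ) : ℂ) * Complex.I by
    push_cast; ring, Complex.norm_exp_ofReal_mul_I]

theorem norm_measureFourier_le (μ : Measure ℝ) [IsFiniteMeasure μ] (ξ : ℝ) :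
    ‖measureFourier μ ξ‖ ≤ μ.real univ := by
  refine (norm_integral_le_integral_norm _).trans ?_
  simp only [norm_exp_measureFourier_kernel, integral_const, smul_eq_mul, mul_one, le_refl]

theorem sq_norm_measureFourier (μ : Measure ℝ) [IsFiniteMeasure μ] (ξ : ℝ) :
    ((‖measureFourier μ ξ‖ ^ 2 : ℝ) : ℂ) =
      ∫ p, Complex.exp (-2 * Real.pi * Complex.I * (p.1 - p.2 : ℝ) * ξ) ∂(μ.prod μ) := by
  have h := integral_prod_mul (μ := μ) (ν := μ)
    (fun x : ℝ => Complex.exp (-2 * Real.pi * Complex.I * x * ξ))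
    (fun x : ℝ => (starRingEnd ℂ) (Complex.exp (-2 * Real.pi * Complex.I * x * ξ)))
  rw [integral_conj] at h
  rw [Complex.ofReal_pow, ← Complex.mul_conj']
  refine h.symm.trans (integral_congr_ae (Filter.Eventually.of_forall fun p => ?_))
  simp only
  rw [← Complex.exp_conj, ← Complex.exp_add]
  congr 1
  simp only [map_mul, map_neg, Complex.conj_ofReal, Complex.conj_I, Complex.conj_ofNat]
  push_cast
  ring

/-- The Gaussian-weighted `L²` mass of the Fourier transform is a Gaussian energy. -/
theorem integral_sq_norm_measureFourier_mul_gaussian (μ : Measure ℝ) [IsFiniteMeasure μ] {r : ℝ}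
    (hr : 0 < r) :
    ∫ ξ : ℝ, ‖measureFourier μ ξ‖ ^ 2 * Real.exp (-(Real.pi * r ^ 2) * ξ ^ 2) =
      ∫ p, r⁻¹ * Real.exp (-Real.pi * (p.1 - p.2) ^ 2 / r ^ 2) ∂(μ.prod μ) := by
  have hb : 0 < Real.pi * r ^ 2 := by positivity
  rw [← Complex.ofReal_inj, ← integral_complex_ofReal, ← integral_complex_ofReal]
  have hint : Integrable (Function.uncurry fun (ξ : ℝ) (p : ℝ × ℝ) =>
      Complex.exp (-2 * Real.pi * Complex.I * (p.1 - p.2 : ℝ) * ξ) *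
        Complex.exp (-((Real.pi * r ^ 2 : ℝ) : ℂ) * ξ ^ 2)) (volume.prod (μ.prod μ)) := by
    have h1 : Integrable (fun q : ℝ × (ℝ × ℝ) => Real.exp (-(Real.pi * r ^ 2) * q.1 ^ 2) * (1 : ℝ))
        (volume.prod (μ.prod μ)) :=
      (integrable_exp_neg_mul_sq hb).mul_prod (integrable_const (1 : ℝ))
    refine h1.mono' ?_ (Filter.Eventually.of_forall ?_)
    · apply Measurable.aestronglyMeasurable
      fun_prop
    · rintro ⟨ξ, p⟩
      simp only [Function.uncurry_apply_pair, norm_mul, norm_exp_measureFourier_kernel, one_mul,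
        mul_one]
      rw [show (-((Real.pi * r ^ 2 : ℝ) : ℂ) * (ξ : ℂ) ^ 2) =
        ((-(Real.pi * r ^ 2) * ξ ^ 2 : ℝ) : ℂ) by push_cast; ring, Complex.norm_exp_ofReal]
  have hswap := integral_integral_swap hint
  convert hswap using 1
  · congr 1
    ext ξ
    rw [Complex.ofReal_mul, sq_norm_measureFourier, ← integral_mul_const]
    congr 1
    ext p
    push_cast
    ring_nf
  · congr 1
    ext p
    rw [integral_exp_mul_gaussian hr]

/-- On `|x - y| ≤ r` the Gaussian kernel of width `r` is at least `exp (-π) / r`. Its energy equals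
the `L²` mass of the transform against a Gaussian of width about `1 / r`, which the decay bounds by
a multiple of `r ^ (s - 1)`; integrability of `|ξ| ^ (-s)` at the origin requires `s < 1`. -/
theorem HasFourierDecay.correlation_le {μ : Measure ℝ} [IsFiniteMeasure μ] {s : ℝ} (hs1 : s < 1)
    (h : HasFourierDecay μ s) : ∃ C : ℝ, ∀ r : ℝ, 0 < r →
      (μ.prod μ) {p | |p.1 - p.2| ≤ r} ≤ ENNReal.ofReal (C * r ^ s) := by
  obtain ⟨C, hC⟩ := h
  have hC' : ∀ ξ : ℝ, ξ ≠ 0 → ‖measureFourier μ ξ‖ ^ 2 ≤ C * |ξ| ^ (-s) := by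
    intro ξ hξ
    have h1 : ‖measureFourier μ ξ‖ ^ 2 * |ξ| ^ s ≤ C := hC ⟨ξ, rfl⟩
    rw [Real.rpow_neg (abs_nonneg _), ← div_eq_mul_inv,
      le_div_iff₀ (Real.rpow_pos_of_pos (abs_pos.2 hξ) _)]
    exact h1
  refine ⟨Real.exp Real.pi * C * (Real.pi ^ (-(1 - s) / 2) * Real.Gamma ((1 - s) / 2)),
    fun r hr => ?_⟩
  have hb : 0 < Real.pi * r ^ 2 := by positivity
  obtain ⟨hint, hval⟩ := integral_abs_rpow_mul_exp hs1 hb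
  have h1 : ∫ ξ : ℝ, ‖measureFourier μ ξ‖ ^ 2 * Real.exp (-(Real.pi * r ^ 2) * ξ ^ 2) ≤
      C * (r ^ (s - 1) * (Real.pi ^ (-(1 - s) / 2) * Real.Gamma ((1 - s) / 2))) := by
    calc _ ≤ ∫ ξ : ℝ, C * (|ξ| ^ (-s) * Real.exp (-(Real.pi * r ^ 2) * |ξ| ^ (2 : ℝ))) := by
          refine integral_mono_of_nonneg (Filter.Eventually.of_forall fun ξ => by positivity)
            (hint.const_mul _) ?_
          have : ∀ᵐ ξ : ℝ, ξ ≠ 0 := by simp [ae_iff]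
          filter_upwards [this] with ξ hξ
          rw [Real.rpow_two, sq_abs, ← mul_assoc]
          gcongr
          exact hC' ξ hξ
      _ = _ := by
          rw [integral_const_mul, hval, Real.mul_rpow Real.pi_pos.le (by positivity),
            ← Real.rpow_natCast, ← Real.rpow_mul hr.le]
          rw [show ((2 : ℕ) : ℝ) * (-(1 - s) / 2) = s - 1 by push_cast; ring]
          ring
  rw [integral_sq_norm_measureFourier_mul_gaussian μ hr] at h1
  set S := {p : ℝ × ℝ | |p.1 - p.2| ≤ r} with hS
  have hSm : MeasurableSet S := measurableSet_abs_sub_le r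
  have hgint : Integrable (fun p : ℝ × ℝ => r⁻¹ * Real.exp (-Real.pi * (p.1 - p.2) ^ 2 / r ^ 2))
      (μ.prod μ) := by
    refine (integrable_const r⁻¹).mono' ?_ (Filter.Eventually.of_forall fun p => ?_)
    · apply Measurable.aestronglyMeasurable
      fun_prop
    · rw [Real.norm_of_nonneg (by positivity)]
      refine mul_le_of_le_one_right (by positivity) (Real.exp_le_one_iff.2 ?_)
      rw [neg_mul, neg_div]
      exact neg_nonpos.2 (by positivity)
  have h2 : (μ.prod μ).real S * (r⁻¹ * Real.exp (-Real.pi)) ≤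
      ∫ p, r⁻¹ * Real.exp (-Real.pi * (p.1 - p.2) ^ 2 / r ^ 2) ∂(μ.prod μ) := by
    calc _ = ∫ p in S, r⁻¹ * Real.exp (-Real.pi) ∂(μ.prod μ) := by
          rw [setIntegral_const, smul_eq_mul]
      _ ≤ ∫ p in S, r⁻¹ * Real.exp (-Real.pi * (p.1 - p.2) ^ 2 / r ^ 2) ∂(μ.prod μ) := by
          refine setIntegral_mono_on (integrable_const _) hgint.integrableOn hSm
            fun p hp => ?_
          have hp' : (p.1 - p.2) ^ 2 ≤ r ^ 2 := sq_le_sq' (abs_le.1 hp).1 (abs_le.1 hp).2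
          gcongr
          rw [le_div_iff₀ (by positivity)]
          nlinarith [Real.pi_pos]
      _ ≤ _ := setIntegral_le_integral hgint (Filter.Eventually.of_forall fun p => by positivity)
  have h3 := h2.trans h1
  rw [← ofReal_measureReal]
  refine ENNReal.ofReal_le_ofReal ?_
  have e1 : (μ.prod μ).real S = (μ.prod μ).real S * (r⁻¹ * Real.exp (-Real.pi)) *
      (r * Real.exp Real.pi) := by
    rw [mul_assoc, show r⁻¹ * Real.exp (-Real.pi) * (r * Real.exp Real.pi) =
      (r⁻¹ * r) * (Real.exp (-Real.pi) * Real.exp Real.pi) by ring, ← Real.exp_add,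
      inv_mul_cancel₀ hr.ne']
    simp
  rw [e1]
  calc _ ≤ C * (r ^ (s - 1) * (Real.pi ^ (-(1 - s) / 2) * Real.Gamma ((1 - s) / 2))) *
        (r * Real.exp Real.pi) := by gcongr
    _ = Real.exp Real.pi * C * (Real.pi ^ (-(1 - s) / 2) * Real.Gamma ((1 - s) / 2)) *
        (r ^ (s - 1) * r) := by ring
    _ = _ := by rw [← Real.rpow_add_one hr.ne', sub_add_cancel]

/-! ### Correlation, Hausdorff dimension and Fourier dimension. -/

/-- Correlation controls balls only on average. Giving up a little of the exponent turns this into a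
pointwise bound `μ (B(x, δ)) ≲ δ ^ t` on a set of positive measure, to which the mass distribution
principle applies. -/
theorem HasCorrelation.ofReal_le_dimH {A : Set ℝ} {s : ℝ} (h : HasCorrelation A s) :
    ENNReal.ofReal s ≤ dimH A := by
  refine le_of_forall_lt fun c hc => ?_
  obtain ⟨t, hct, hts⟩ := ENNReal.lt_iff_exists_nnreal_btwn.1 hc
  refine hct.trans_le ?_
  rcases eq_or_ne t 0 with rfl | ht0
  · simp
  have ht0 : 0 < t := pos_iff_ne_zero.2 ht0
  have hts' : (t : ℝ) < s := by
    rw [ENNReal.lt_ofReal_iff_toReal_lt ENNReal.coe_ne_top] at hts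
    simpa using hts
  obtain ⟨μ, hμf, hμ0, hμA, C, hC⟩ := h
  have hball (δ : ℝ) : Measurable fun x => μ (Metric.closedBall x δ) := by
    have := measurable_measure_prodMk_left (ν := μ) (measurableSet_abs_sub_le δ)
    convert this using 3 with x
    ext y
    simp [Real.dist_eq, abs_sub_comm]
  have hballint (δ : ℝ) : ∫⁻ x, μ (Metric.closedBall x δ) ∂μ =
      (μ.prod μ) {p | |p.1 - p.2| ≤ δ} := by
    rw [Measure.prod_apply (measurableSet_abs_sub_le δ)]
    congr 1
    ext x
    congr 1
    ext y
    simp [Real.dist_eq, abs_sub_comm]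
  -- Weighted ball masses over all dyadic scales. The integral converges since `t < s`, and any
  -- bound `φ x ≤ N` is a Frostman condition at `x`.
  set φ : ℝ → ℝ≥0∞ := fun x =>
    ∑' k : ℕ, ENNReal.ofReal ((2 ^ (t : ℝ)) ^ k) * μ (Metric.closedBall x ((1 / 2) ^ k)) with hφ
  have hφm : Measurable φ := Measurable.tsum fun k => (hball _).const_mul _
  have hφint : ∫⁻ x, φ x ∂μ < ∞ := by
    calc ∫⁻ x, φ x ∂μ = ∑' k : ℕ, ENNReal.ofReal ((2 ^ (t : ℝ)) ^ k) *
          (μ.prod μ) {p | |p.1 - p.2| ≤ (1 / 2) ^ k} := by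
          rw [hφ, lintegral_tsum fun k => ((hball _).const_mul _).aemeasurable]
          congr 1
          ext k
          rw [lintegral_const_mul _ (hball _), hballint]
      _ ≤ ∑' k : ℕ, ENNReal.ofReal (|C| * (2 ^ (t : ℝ) * (1 / 2) ^ s) ^ k) := by
          gcongr with k
          refine (mul_le_mul_right (hC _ (by positivity)) _).trans ?_
          rw [← ENNReal.ofReal_mul (by positivity)]
          refine ENNReal.ofReal_le_ofReal ?_
          have : (((1 / 2 : ℝ)) ^ k) ^ s = ((1 / 2) ^ s) ^ k := by
            rw [← Real.rpow_natCast, ← Real.rpow_natCast, ← Real.rpow_mul (by norm_num),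
              ← Real.rpow_mul (by norm_num), mul_comm]
          rw [this, mul_pow]
          have h2 : C ≤ |C| := le_abs_self C
          have h3 : (0 : ℝ) ≤ (2 ^ (t : ℝ)) ^ k * ((1 / 2) ^ s) ^ k := by positivity
          nlinarith
      _ < ∞ := by
          rw [← ENNReal.ofReal_tsum_of_nonneg (fun k => by positivity)]
          · exact ENNReal.ofReal_lt_top
          · refine (summable_geometric_of_lt_one (by positivity) ?_).mul_left _
            rw [one_div, Real.inv_rpow two_pos.le, ← Real.rpow_neg two_pos.le,
              ← Real.rpow_add two_pos]
            exact Real.rpow_lt_one_of_one_lt_of_neg one_lt_two (by linarith)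
  obtain ⟨N, hN⟩ : ∃ N : ℕ, μ {x | φ x ≤ N} ≠ 0 := by
    by_contra! hall
    have h1 : μ (⋃ N : ℕ, {x | φ x ≤ N}) = 0 := measure_iUnion_null hall
    refine hμ0 ?_
    rw [← Measure.measure_univ_eq_zero]
    refine measure_mono_null (t := (⋃ N : ℕ, {x | φ x ≤ N}) ∪ {x | φ x = ∞}) (fun x _ => ?_)
      (measure_union_null h1 ?_)
    · by_cases hx : φ x = ∞
      · exact Or.inr hx
      · left
        obtain ⟨n, hn⟩ := ENNReal.exists_nat_gt hx
        exact mem_iUnion.2 ⟨n, hn.le⟩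
    · have := ae_lt_top hφm hφint.ne
      rw [ae_iff] at this
      simpa using this
  set G := {x | φ x ≤ N} with hG
  have hGm : MeasurableSet G := measurableSet_le hφm measurable_const
  have hGball : ∀ x ∈ G, ∀ δ : ℝ, 0 < δ → δ ≤ 1 → μ (Metric.closedBall x δ) ≤
      ENNReal.ofReal (N * 2 ^ (t : ℝ)) * ENNReal.ofReal δ ^ (t : ℝ) := by
    intro x hx δ hδ hδ1
    obtain ⟨k, hk1, hk2⟩ := exists_nat_pow_near_of_lt_one hδ hδ1
      (by norm_num : (0 : ℝ) < 1 / 2) (by norm_num)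
    have h1 : ENNReal.ofReal ((2 ^ (t : ℝ)) ^ k) * μ (Metric.closedBall x ((1 / 2) ^ k)) ≤ N :=
      (ENNReal.le_tsum k).trans hx
    have h2 : μ (Metric.closedBall x δ) ≤ μ (Metric.closedBall x ((1 / 2) ^ k)) :=
      measure_mono (Metric.closedBall_subset_closedBall hk2)
    have h3 : (1 : ℝ≥0∞) ≤ ENNReal.ofReal ((2 ^ (t : ℝ)) ^ k) *
        (ENNReal.ofReal (2 ^ (t : ℝ)) * ENNReal.ofReal δ ^ (t : ℝ)) := by
      rw [ENNReal.ofReal_rpow_of_pos hδ, ← ENNReal.ofReal_mul (by positivity),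
        ← ENNReal.ofReal_mul (by positivity), ENNReal.one_le_ofReal, ← mul_assoc, ← pow_succ,
        ← Real.rpow_natCast, ← Real.rpow_mul two_pos.le, mul_comm (t : ℝ), Real.rpow_mul two_pos.le,
        ← Real.mul_rpow (by positivity) hδ.le]
      refine Real.one_le_rpow ?_ t.2
      rw [one_div, inv_pow, inv_lt_iff_one_lt_mul₀ (by positivity)] at hk1
      rw [Real.rpow_natCast]
      linarith
    calc μ (Metric.closedBall x δ) = 1 * μ (Metric.closedBall x δ) := (one_mul _).symm
      _ ≤ (ENNReal.ofReal ((2 ^ (t : ℝ)) ^ k) *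
        (ENNReal.ofReal (2 ^ (t : ℝ)) * ENNReal.ofReal δ ^ (t : ℝ))) *
          μ (Metric.closedBall x ((1 / 2) ^ k)) := by gcongr
      _ = (ENNReal.ofReal ((2 ^ (t : ℝ)) ^ k) * μ (Metric.closedBall x ((1 / 2) ^ k))) *
        ENNReal.ofReal (2 ^ (t : ℝ)) * ENNReal.ofReal δ ^ (t : ℝ) := by ring
      _ ≤ N * ENNReal.ofReal (2 ^ (t : ℝ)) * ENNReal.ofReal δ ^ (t : ℝ) := by gcongr
      _ = _ := by rw [ENNReal.ofReal_mul (by positivity), ENNReal.ofReal_natCast]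
  -- The summand `1` only ensures `K ≠ 0`, so that dividing by `K` is legitimate.
  set K := ENNReal.ofReal (N * 2 ^ (t : ℝ)) + 1 with hK
  have hK0 : K ≠ 0 := by simp [hK]
  have hKt : K ≠ ∞ := ENNReal.add_ne_top.2 ⟨ENNReal.ofReal_ne_top, ENNReal.one_ne_top⟩
  have hset : ∀ U : Set ℝ, Metric.ediam U ≤ 1 →
      (K⁻¹ • μ.restrict G) U ≤ Metric.ediam U ^ (t : ℝ) := by
    intro U hU
    rw [Measure.smul_apply, Measure.restrict_apply' hGm, smul_eq_mul, mul_comm, ← div_eq_mul_inv,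
      ENNReal.div_le_iff hK0 hKt, mul_comm]
    rcases (U ∩ G).eq_empty_or_nonempty with he | ⟨x, hxU, hxG⟩
    · simp [he]
    have hUt : Metric.ediam U ≠ ∞ := (hU.trans_lt ENNReal.one_lt_top).ne
    have hsub : ∀ δ : ℝ, 0 ≤ δ → Metric.ediam U ≤ ENNReal.ofReal δ →
        U ∩ G ⊆ Metric.closedBall x δ := by
      intro δ hδ0 hδ y hy
      rw [Metric.mem_closedBall, ← edist_le_ofReal hδ0]
      exact (Metric.edist_le_ediam_of_mem hy.1 hxU).trans hδ
    -- The ball bound requires a positive radius, so sets of diameter zero are handled by letting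
    -- the radius tend to `0`.
    rcases eq_or_ne (Metric.ediam U) 0 with h0 | h0
    · have hlim : Filter.Tendsto (fun n : ℕ => ENNReal.ofReal (N * 2 ^ (t : ℝ)) *
          ENNReal.ofReal ((1 / 2) ^ n) ^ (t : ℝ)) Filter.atTop (nhds 0) := by
        have h1 : Filter.Tendsto (fun n : ℕ => ENNReal.ofReal ((1 / 2) ^ n)) Filter.atTop
            (nhds 0) := by
          rw [← ENNReal.ofReal_zero]
          exact ENNReal.tendsto_ofReal
            (tendsto_pow_atTop_nhds_zero_of_lt_one (by norm_num) (by norm_num))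
        have h2 := ENNReal.Tendsto.const_mul (a := ENNReal.ofReal (N * 2 ^ (t : ℝ)))
          ((ENNReal.continuous_rpow_const (y := (t : ℝ))).continuousAt.tendsto.comp h1)
          (Or.inr ENNReal.ofReal_ne_top)
        rw [ENNReal.zero_rpow_of_pos (by exact_mod_cast ht0), mul_zero] at h2
        exact h2
      have : μ (U ∩ G) ≤ 0 := ge_of_tendsto' hlim fun n =>
        (measure_mono (hsub _ (by positivity) (by simp [h0]))).trans
          (hGball x hxG _ (by positivity) (pow_le_one₀ (by norm_num) (by norm_num)))
      exact this.trans zero_le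
    · have hpos : 0 < (Metric.ediam U).toReal := ENNReal.toReal_pos h0 hUt
      calc μ (U ∩ G) ≤ μ (Metric.closedBall x (Metric.ediam U).toReal) :=
            measure_mono (hsub _ hpos.le (ENNReal.ofReal_toReal hUt).ge)
        _ ≤ ENNReal.ofReal (N * 2 ^ (t : ℝ)) * ENNReal.ofReal (Metric.ediam U).toReal ^ (t : ℝ) :=
            hGball x hxG _ hpos (ENNReal.toReal_le_of_le_ofReal zero_le_one (by simpa using hU))
        _ ≤ K * Metric.ediam U ^ (t : ℝ) := by
            rw [ENNReal.ofReal_toReal hUt]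
            gcongr
            exact le_self_add
  have hle := Measure.le_hausdorffMeasure (t : ℝ) (K⁻¹ • μ.restrict G) 1 one_pos hset
  refine le_dimH_of_hausdorffMeasure_ne_zero fun h0 => ?_
  have h1 := (hle A).trans_eq h0
  rw [Measure.smul_apply, Measure.restrict_apply' hGm, smul_eq_mul, nonpos_iff_eq_zero,
    mul_eq_zero, ENNReal.inv_eq_zero] at h1
  have h2 : μ (A ∩ G) = 0 := h1.resolve_left hKt
  refine hN (measure_mono_null (t := (A ∩ G) ∪ Aᶜ) (fun x hx => ?_) (measure_union_null h2 hμA))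
  by_cases hxA : x ∈ A
  · exact Or.inl ⟨hxA, hx⟩
  · exact Or.inr hxA

/-- A point mass suffices; this covers summands of dimension zero. -/
theorem hasCorrelation_zero {A : Set ℝ} (h : A.Nonempty) : HasCorrelation A 0 := by
  obtain ⟨x, hx⟩ := h
  refine ⟨Measure.dirac x, inferInstance, Measure.dirac_ne_zero, ?_, 1, fun r hr => ?_⟩
  · rw [Measure.dirac_apply]
    simp [hx]
  · simpa using prob_le_one

theorem HasFourierDecay.mono {μ : Measure ℝ} [IsFiniteMeasure μ] {s t : ℝ} (ht : 0 ≤ t)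
    (hts : t ≤ s) (h : HasFourierDecay μ s) : HasFourierDecay μ t := by
  obtain ⟨C, hC⟩ := h
  refine ⟨max C (μ.real univ ^ 2), ?_⟩
  rintro _ ⟨ξ, rfl⟩
  simp only
  rcases le_total 1 |ξ| with h1 | h1
  · refine le_trans ?_ ((hC ⟨ξ, rfl⟩).trans (le_max_left _ _))
    simp only
    gcongr
  · refine le_trans ?_ (le_max_right _ _)
    calc _ ≤ μ.real univ ^ 2 * 1 := by
          gcongr
          · exact norm_measureFourier_le μ ξ
          · exact Real.rpow_le_one (abs_nonneg _) h1 ht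
      _ = _ := mul_one _

theorem HasFourierDecay.hasCorrelation {A : Set ℝ} {μ : Measure ℝ} {s t : ℝ}
    (hμ : μ ∈ compactlySupportedMeasures A) (h : HasFourierDecay μ s) (ht : 0 ≤ t) (hts : t ≤ s)
    (ht1 : t < 1) : HasCorrelation A t := by
  obtain ⟨hf, h0, -, hA⟩ := hμ
  exact ⟨μ, hf, h0, measure_mono_null (compl_subset_compl.2 hA) Measure.measure_compl_support,
    (h.mono ht hts).correlation_le ht1⟩

/-- The supremum runs over `s ≤ 1`, so a value strictly below some admissible `s` is automatically
below `1`, as the Gaussian argument needs. -/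
theorem hasCorrelation_of_lt_fourierDim {A : Set ℝ} {t : ℝ≥0} (h : (t : ℝ≥0∞) < fourierDim A) :
    HasCorrelation A t := by
  rw [fourierDim] at h
  obtain ⟨s, hs⟩ := lt_iSup_iff.1 h
  obtain ⟨⟨hs1, μ, hμ, hdec⟩, hts⟩ := lt_iSup_iff.1 hs
  have hts : t < s := by exact_mod_cast hts
  exact hdec.hasCorrelation hμ t.2 (by exact_mod_cast hts.le) (by exact_mod_cast hts.trans_le hs1)

theorem fourierDim_le_dimH (A : Set ℝ) : fourierDim A ≤ dimH A := by
  refine ENNReal.le_of_forall_nnreal_lt fun t ht => ?_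
  simpa using (hasCorrelation_of_lt_fourierDim ht).ofReal_le_dimH

/-- A measure of positive correlation dimension has no atoms, hence can be moved away from `0`. -/
theorem HasCorrelation.exists_away_from_zero {A : Set ℝ} {s : ℝ} (hs : 0 < s)
    (h : HasCorrelation A s) : ∃ m : ℝ, 0 < m ∧ HasCorrelation (A ∩ {y | m ≤ |y|}) s := by
  obtain ⟨μ, hf, h0, hA, C, hC⟩ := h
  have hz : μ {0} = 0 := by
    have hlim : Filter.Tendsto (fun n : ℕ => ENNReal.ofReal (C * ((1 / 2 : ℝ) ^ n) ^ s))
        Filter.atTop (nhds 0) := by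
      rw [← ENNReal.ofReal_zero]
      refine ENNReal.tendsto_ofReal ?_
      have h1 : Filter.Tendsto (fun n : ℕ => ((1 / 2 : ℝ) ^ n)) Filter.atTop (nhds 0) :=
        tendsto_pow_atTop_nhds_zero_of_lt_one (by norm_num) (by norm_num)
      have h2 := (h1.rpow_const (p := s) (Or.inr hs.le)).const_mul C
      rwa [Real.zero_rpow hs.ne', mul_zero] at h2
    have h1 : μ {0} * μ {0} ≤ 0 := by
      rw [← Measure.prod_prod]
      refine ge_of_tendsto' hlim fun n => (measure_mono ?_).trans (hC _ (by positivity))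
      rintro ⟨x, y⟩ ⟨hx, hy⟩
      rw [mem_singleton_iff] at hx hy
      simp only at hx hy
      subst hx hy
      simp
    simpa using h1
  obtain ⟨n, hn⟩ : ∃ n : ℕ, μ {y | ((1 / 2 : ℝ)) ^ n ≤ |y|} ≠ 0 := by
    by_contra! hall
    refine h0 ?_
    rw [← Measure.measure_univ_eq_zero]
    refine measure_mono_null (t := (⋃ n : ℕ, {y | ((1 / 2 : ℝ)) ^ n ≤ |y|}) ∪ {0}) (fun y _ => ?_)
      (measure_union_null (measure_iUnion_null hall) hz)
    rcases eq_or_ne y 0 with rfl | hy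
    · exact Or.inr rfl
    · obtain ⟨n, hn⟩ := exists_pow_lt_of_lt_one (abs_pos.2 hy) (by norm_num : (1 / 2 : ℝ) < 1)
      exact Or.inl (mem_iUnion.2 ⟨n, hn.le⟩)
  have hm : MeasurableSet {y : ℝ | ((1 / 2 : ℝ)) ^ n ≤ |y|} :=
    measurableSet_le measurable_const (by fun_prop)
  refine ⟨(1 / 2) ^ n, by positivity, μ.restrict {y | ((1 / 2 : ℝ)) ^ n ≤ |y|}, inferInstance, ?_,
    ?_, C, fun r hr => le_trans ?_ (hC r hr)⟩
  · rwa [Ne, Measure.restrict_eq_zero]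
  · rw [compl_inter]
    refine measure_union_null (Measure.restrict_le_self.absolutelyContinuous hA) ?_
    rw [Measure.restrict_apply hm.compl, compl_inter_self, measure_empty]
  · rw [Measure.prod_restrict]
    exact Measure.restrict_apply_le _ _

theorem HasCorrelation.of_image_add {A : Set ℝ} {s : ℝ} (c : ℝ)
    (h : HasCorrelation ((fun x => x + c) '' A) s) : HasCorrelation A s := by
  obtain ⟨μ, hf, h0, hA, C, hC⟩ := h
  have hm : Measurable fun x : ℝ => x - c := by fun_prop
  refine ⟨μ.map (fun x => x - c), inferInstance, ?_, ?_, C, fun r hr => ?_⟩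
  · rwa [Ne, Measure.map_eq_zero_iff hm.aemeasurable]
  · have e : (fun x : ℝ => x - c) = (MeasurableEquiv.subRight c : ℝ ≃ᵐ ℝ) := rfl
    rw [e, MeasurableEquiv.map_apply]
    refine measure_mono_null (t := ((fun x => x + c) '' A)ᶜ) ?_ hA
    rintro x hx ⟨a, ha, rfl⟩
    refine hx ?_
    rwa [show (MeasurableEquiv.subRight c : ℝ ≃ᵐ ℝ) (a + c) = a from add_sub_cancel_right a c]
  · rw [Measure.map_prod_map _ _ hm hm, Measure.map_apply (by fun_prop) (measurableSet_abs_sub_le r)]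
    refine le_trans (measure_mono fun p hp => ?_) (hC r hr)
    simpa using hp

/-! ### Dyadic masses and Frostman's lemma. -/

/-- The half-open dyadic interval `(k / 2 ^ n, (k + 1) / 2 ^ n]`. -/
def dyadicIoc (n k : ℕ) : Set ℝ := Ioc (k * (1 / 2 : ℝ) ^ n) ((k + 1 : ℕ) * (1 / 2 : ℝ) ^ n)

theorem two_pow_mul_half_pow (n : ℕ) : (2 : ℝ) ^ n * (1 / 2) ^ n = 1 := by
  rw [← mul_pow]; norm_num

theorem exists_mem_dyadicIoc {x : ℝ} (hx : 0 < x) (n : ℕ) : ∃ k, x ∈ dyadicIoc n k := by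
  have h2 : 0 < (2 : ℝ) ^ n := by positivity
  have hpos : 0 < ⌈2 ^ n * x⌉₊ := Nat.ceil_pos.2 (by positivity)
  refine ⟨⌈2 ^ n * x⌉₊ - 1, ?_, ?_⟩
  · have h1 : ((⌈2 ^ n * x⌉₊ - 1 : ℕ) : ℝ) < 2 ^ n * x := Nat.lt_ceil.1 (by omega)
    calc _ < 2 ^ n * x * (1 / 2 : ℝ) ^ n := by gcongr
      _ = (2 ^ n * (1 / 2) ^ n) * x := by ring
      _ = x := by rw [two_pow_mul_half_pow, one_mul]
  · rw [Nat.sub_add_cancel hpos]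
    calc x = (2 ^ n * (1 / 2) ^ n) * x := by rw [two_pow_mul_half_pow, one_mul]
      _ = 2 ^ n * x * (1 / 2 : ℝ) ^ n := by ring
      _ ≤ _ := by gcongr; exact Nat.le_ceil _

/-- A consistent system of masses of dyadic intervals decaying like `|I| ^ t` is realised by a
measure. -/
theorem exists_measure_of_dyadic_mass {m : ℕ → ℕ → ℝ} {t : ℝ} (ht : 0 < t)
    (h0 : ∀ n k, 0 ≤ m n k) (hadd : ∀ n k, m (n + 1) (2 * k) + m (n + 1) (2 * k + 1) = m n k)
    (hle : ∀ n k, m n k ≤ ((1 / 2 : ℝ) ^ n) ^ t) (hm0 : ∀ k, 1 ≤ k → m 0 k = 0) :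
    ∃ ν : Measure ℝ, IsFiniteMeasure ν ∧ (∀ n k, ν (dyadicIoc n k) = ENNReal.ofReal (m n k)) ∧
      ν (Iic 0) = 0 ∧ ∃ C : ℝ, ∀ r : ℝ, 0 < r →
        (ν.prod ν) {p | |p.1 - p.2| ≤ r} ≤ ENNReal.ofReal (C * r ^ t) := by
  -- `T n j` is the prospective mass of `(0, j / 2 ^ n]`. Refining the grid does not change it, so
  -- the values fit together into one distribution function `F`, and the decay of `m` makes `F`
  -- Hölder, hence right-continuous.
  set T : ℕ → ℕ → ℝ := fun n j => ∑ k ∈ Finset.range j, m n k with hT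
  have hT1 (n j) : T (n + 1) (2 * j) = T n j := by
    induction j with
    | zero => simp [hT]
    | succ j ih =>
      have e1 : T (n + 1) (2 * (j + 1)) = T (n + 1) (2 * j) + m (n + 1) (2 * j) +
          m (n + 1) (2 * j + 1) := by
        simp only [hT, show 2 * (j + 1) = 2 * j + 1 + 1 by ring, Finset.sum_range_succ]
      have e2 : T n (j + 1) = T n j + m n j := Finset.sum_range_succ _ _
      rw [e1, e2, ih, add_assoc, hadd]
  have hTi (n i j) : T (n + i) (2 ^ i * j) = T n j := by
    induction i with
    | zero => simp
    | succ i ih => rw [← add_assoc, pow_succ', mul_assoc, hT1, ih]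
  have hTmono (n) : Monotone (T n) := fun i j hij =>
    Finset.sum_le_sum_of_subset_of_nonneg (Finset.range_mono hij) fun k _ _ => h0 n k
  have hT0 (j) : T 0 j ≤ m 0 0 := by
    rcases j with _ | j
    · simpa [hT] using h0 0 0
    · simp only [hT, Finset.sum_range_succ']
      rw [Finset.sum_eq_zero fun k _ => hm0 _ (by omega), zero_add]
  have hTle (n j) : T n j ≤ m 0 0 := by
    calc T n j ≤ T n (2 ^ n * j) := hTmono n (Nat.le_mul_of_pos_left _ (by positivity))
      _ = T 0 j := by simpa using hTi 0 n j
      _ ≤ _ := hT0 j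
  set G : ℕ → ℝ → ℝ := fun n x => T n ⌊2 ^ n * x⌋₊ with hG
  have hGb (x) : BddAbove (range fun n => G n x) := ⟨m 0 0, by rintro _ ⟨n, rfl⟩; exact hTle _ _⟩
  set F : ℝ → ℝ := fun x => ⨆ n, G n x with hF
  have hGF (n x) : G n x ≤ F x := le_ciSup (hGb x) n
  have hGstep (x) : Monotone fun n => G n x := by
    refine monotone_nat_of_le_succ fun n => ?_
    simp only [hG]
    rw [← hT1]
    refine hTmono _ ?_
    rcases le_total x 0 with hx | hx
    · rw [Nat.floor_of_nonpos (mul_nonpos_of_nonneg_of_nonpos (by positivity) hx)]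
      simp
    · refine Nat.le_floor ?_
      push_cast
      rw [pow_succ', mul_assoc]
      gcongr
      exact Nat.floor_le (by positivity)
  have hFmono : Monotone F := fun x y hxy =>
    ciSup_mono (hGb y) fun n => hTmono n (Nat.floor_mono (by gcongr))
  have hFd (n j : ℕ) : F (j * (1 / 2 : ℝ) ^ n) = T n j := by
    have key (i : ℕ) : G (n + i) (j * (1 / 2 : ℝ) ^ n) = T n j := by
      simp only [hG]
      rw [← hTi n i j]
      congr 1
      rw [show (2 : ℝ) ^ (n + i) * (j * (1 / 2) ^ n) = ((2 ^ i * j : ℕ) : ℝ) by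
        push_cast
        calc _ = ((2 : ℝ) ^ n * (1 / 2) ^ n) * ((2 : ℝ) ^ i * j) := by ring
          _ = (2 : ℝ) ^ i * j := by rw [two_pow_mul_half_pow, one_mul], Nat.floor_natCast]
    refine le_antisymm (ciSup_le fun N => ?_) ?_
    · rw [← key N]
      exact hGstep _ (Nat.le_add_left _ _)
    · rw [← key 0]
      exact hGF _ _
  have hholder (n : ℕ) (x y : ℝ) (hxy : y ≤ x + (1 / 2) ^ n) :
      F y - F x ≤ 2 * ((1 / 2 : ℝ) ^ n) ^ t := by
    set j := ⌊2 ^ n * x⌋₊ with hj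
    have h1 : T n j ≤ F x := hGF n x
    have h2 : F y ≤ T n (j + 2) := by
      rw [← hFd]
      refine hFmono (hxy.trans ?_)
      have : (2 : ℝ) ^ n * x ≤ j + 1 := (Nat.lt_floor_add_one _).le
      calc x + (1 / 2) ^ n = (2 ^ n * (1 / 2) ^ n) * x + (1 / 2) ^ n := by
            rw [two_pow_mul_half_pow, one_mul]
        _ = 2 ^ n * x * (1 / 2) ^ n + (1 / 2) ^ n := by ring
        _ ≤ (j + 1) * (1 / 2) ^ n + (1 / 2) ^ n := by gcongr
        _ = _ := by push_cast; ring
    have h3 : T n (j + 2) = T n j + m n j + m n (j + 1) := by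
      simp only [hT, Finset.sum_range_succ]
    linarith [hle n j, hle n (j + 1)]
  have hlim : Filter.Tendsto (fun n : ℕ => 2 * ((1 / 2 : ℝ) ^ n) ^ t) Filter.atTop (nhds 0) := by
    have h1 : Filter.Tendsto (fun n : ℕ => ((1 / 2 : ℝ) ^ n)) Filter.atTop (nhds 0) :=
      tendsto_pow_atTop_nhds_zero_of_lt_one (by norm_num) (by norm_num)
    have h2 := (h1.rpow_const (p := t) (Or.inr ht.le)).const_mul 2
    rwa [Real.zero_rpow ht.ne', mul_zero] at h2
  have hcont (x : ℝ) : ContinuousWithinAt F (Ici x) x := by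
    rw [Metric.continuousWithinAt_iff]
    intro ε hε
    obtain ⟨n, hn⟩ := (hlim.eventually_lt_const hε).exists
    refine ⟨(1 / 2) ^ n, by positivity, fun y hy hyx => ?_⟩
    rw [Real.dist_eq, abs_of_nonneg (sub_nonneg.2 hy)] at hyx
    rw [Real.dist_eq, abs_of_nonneg (sub_nonneg.2 (hFmono hy))]
    exact (hholder n x y (by linarith)).trans_lt hn
  have hF0 (x : ℝ) (hx : x ≤ 0) : F x = 0 := by
    simp only [hF, hG]
    rw [show (fun n : ℕ => T n ⌊2 ^ n * x⌋₊) = fun _ => 0 by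
      ext n
      rw [Nat.floor_of_nonpos (mul_nonpos_of_nonneg_of_nonpos (by positivity) hx)]
      simp [hT]]
    simp
  have hFnn (x) : 0 ≤ F x := (Finset.sum_nonneg fun k _ => h0 _ k).trans (hGF 0 x)
  have hFle (x) : F x ≤ m 0 0 := ciSup_le fun n => hTle _ _
  let f : StieltjesFunction ℝ := ⟨F, hFmono, hcont⟩
  have hfF (x) : f x = F x := rfl
  have hfin : IsFiniteMeasure f.measure := f.isFiniteMeasure_of_forall_abs_le (C := m 0 0)
    fun x => by rw [hfF, abs_of_nonneg (hFnn x)]; exact hFle x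
  have hball (x r : ℝ) (hr : 0 < r) : f.measure {y | |x - y| ≤ r} ≤
      ENNReal.ofReal ((2 + m 0 0) * (6 * r) ^ t) := by
    -- A Stieltjes measure is computed on half-open intervals, so the left end moves out to `x - 2 *
    -- r`. The length is then `3 * r`, and the dyadic length just above it is at most `6 * r`. For
    -- `3 * r > 1` the total mass bound suffices, whence the constant `2 + m 0 0`.
    calc f.measure {y | |x - y| ≤ r} ≤ f.measure (Ioc (x - 2 * r) (x + r)) := by
          refine measure_mono fun y hy => ?_
          rw [mem_ofPred_eq, abs_le] at hy
          exact ⟨by linarith, by linarith⟩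
      _ ≤ _ := by
          rw [f.measure_Ioc, hfF, hfF]
          refine ENNReal.ofReal_le_ofReal ?_
          rcases le_or_gt (3 * r) 1 with h3 | h3
          · obtain ⟨n, hn1, hn2⟩ := exists_nat_pow_near_of_lt_one (by positivity : 0 < 3 * r) h3
              (by norm_num : (0 : ℝ) < 1 / 2) (by norm_num)
            calc _ ≤ 2 * ((1 / 2 : ℝ) ^ n) ^ t := hholder n _ _ (by linarith)
              _ ≤ (2 + m 0 0) * (6 * r) ^ t := by
                rw [pow_succ] at hn1
                have h4 : (1 / 2 : ℝ) ^ n ≤ 6 * r := by linarith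
                have h5 := h0 0 0
                gcongr
                linarith
          · have h1 : 1 ≤ (6 * r) ^ t := Real.one_le_rpow (by linarith) ht.le
            calc _ ≤ m 0 0 := by linarith [hFle (x + r), hFnn (x - 2 * r)]
              _ ≤ (2 + m 0 0) * 1 := by linarith
              _ ≤ _ := by gcongr; linarith [h0 0 0]
  refine ⟨f.measure, hfin, fun n k => ?_, ?_,
    (2 + m 0 0) * 6 ^ t * f.measure.real univ, fun r hr => ?_⟩
  · rw [dyadicIoc, f.measure_Ioc, hfF, hfF, hFd, hFd]
    simp only [hT, Finset.sum_range_succ, add_sub_cancel_left]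
  · refine measure_mono_null (t := ⋃ n : ℕ, Ioc (-(n : ℝ)) 0) (fun x hx => ?_)
      (measure_iUnion_null fun n => ?_)
    · obtain ⟨n, hn⟩ := exists_nat_gt (-x)
      exact mem_iUnion.2 ⟨n, by linarith, hx⟩
    · rw [f.measure_Ioc, hfF, hfF, hF0 _ le_rfl, hF0 _ (by simp)]
      simp
  · rw [Measure.prod_apply (measurableSet_abs_sub_le r)]
    calc _ ≤ ∫⁻ _, ENNReal.ofReal ((2 + m 0 0) * (6 * r) ^ t) ∂f.measure :=
          lintegral_mono fun x => hball x r hr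
      _ = _ := by
          rw [lintegral_const, ← ofReal_measureReal, ← ENNReal.ofReal_mul, Real.mul_rpow]
          · congr 1; ring
          · norm_num
          · exact hr.le
          · have := h0 0 0; positivity

/-- The `t`-dimensional Hausdorff content. -/
noncomputable def hausdorffContent (t : ℝ) (ht : 0 < t) : OuterMeasure ℝ :=
  OuterMeasure.ofFunction (fun U => Metric.ediam U ^ t) (by simp [ENNReal.zero_rpow_of_pos ht])

/-- A cover whose `t`-sum is below `r ^ t` consists of sets of diameter below `r`, so small content
supplies covers at every scale. -/
theorem hausdorffMeasure_eq_zero_of_content {t : ℝ} (ht : 0 < t) {A : Set ℝ}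
    (h : hausdorffContent t ht A = 0) : μH[t] A = 0 := by
  rw [Measure.hausdorffMeasure_apply, ← nonpos_iff_eq_zero]
  refine iSup₂_le fun r hr => ENNReal.le_of_forall_pos_le_add fun ε hε _ => ?_
  rw [zero_add]
  have hpos : 0 < min (ε : ℝ≥0∞) (r ^ t) :=
    lt_min (by exact_mod_cast hε) (by
      rcases eq_or_ne r ∞ with rfl | hrt
      · simp [ENNReal.top_rpow_of_pos ht]
      · exact ENNReal.rpow_pos hr hrt)
  rw [hausdorffContent, OuterMeasure.ofFunction_apply] at h
  rw [← h] at hpos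
  obtain ⟨U, hU⟩ := iInf_lt_iff.1 hpos
  obtain ⟨hAU, hU⟩ := iInf_lt_iff.1 hU
  refine (iInf₂_le U hAU).trans ?_
  refine (iInf_le _ fun n => ?_).trans ?_
  · have h1 := ((ENNReal.le_tsum n).trans_lt hU).trans_le (min_le_right _ _)
    exact ((ENNReal.rpow_lt_rpow_iff ht).1 h1).le
  · refine le_trans (ENNReal.tsum_le_tsum fun n => ?_) (hU.le.trans (min_le_left _ _))
    exact iSup_le fun _ => le_rfl

/-- **Frostman's lemma** for a set in the unit interval. -/
theorem hasCorrelation_of_hausdorffMeasure_ne_zero {Z : Set ℝ} (hZ : IsClosed Z) {t : ℝ}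
    (ht : 0 < t) (h : μH[t] (Z ∩ Ioc 0 1) ≠ 0) : HasCorrelation Z t := by
  set A := Z ∩ Ioc (0 : ℝ) 1 with hA
  set c := hausdorffContent t ht with hc
  have hcpos : c A ≠ 0 := fun h0 => h (hausdorffMeasure_eq_zero_of_content ht h0)
  have hcle (n k : ℕ) : c (A ∩ dyadicIoc n k) ≤ ENNReal.ofReal (((1 / 2 : ℝ) ^ n) ^ t) := by
    refine (measure_mono inter_subset_right).trans ((OuterMeasure.ofFunction_le _).trans ?_)
    rw [dyadicIoc, Real.ediam_Ioc, ENNReal.ofReal_rpow_of_nonneg]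
    · refine ENNReal.ofReal_le_ofReal (le_of_eq ?_)
      congr 1
      push_cast
      ring
    · push_cast
      have : (0 : ℝ) < (1 / 2) ^ n := by positivity
      linarith
    · exact ht.le
  have hcfin (n k : ℕ) : c (A ∩ dyadicIoc n k) ≠ ∞ := ne_top_of_le_ne_top ENNReal.ofReal_ne_top
    (hcle n k)
  set H : ℕ → ℕ → ℝ := fun n k => (c (A ∩ dyadicIoc n k)).toReal with hH
  have hH0 (n k) : 0 ≤ H n k := ENNReal.toReal_nonneg
  have hHle (n k) : H n k ≤ ((1 / 2 : ℝ) ^ n) ^ t :=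
    ENNReal.toReal_le_of_le_ofReal (by positivity) (hcle n k)
  have hHsub (n k) : H n k ≤ H (n + 1) (2 * k) + H (n + 1) (2 * k + 1) := by
    simp only [hH]
    rw [← ENNReal.toReal_add (hcfin _ _) (hcfin _ _)]
    refine ENNReal.toReal_mono (ENNReal.add_ne_top.2 ⟨hcfin _ _, hcfin _ _⟩) ?_
    refine (measure_mono ?_).trans (measure_union_le _ _)
    rw [← inter_union_distrib_left]
    refine inter_subset_inter_right _ fun x hx => ?_
    rw [dyadicIoc, mem_Ioc] at hx
    rcases le_or_gt x ((2 * k + 1 : ℕ) * (1 / 2 : ℝ) ^ (n + 1)) with h1 | h1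
    · left
      refine ⟨?_, h1⟩
      refine lt_of_le_of_lt (le_of_eq ?_) hx.1
      push_cast
      ring
    · right
      refine ⟨h1, hx.2.trans (le_of_eq ?_)⟩
      push_cast
      ring
  have hHempty (n k) (he : A ∩ dyadicIoc n k = ∅) : H n k = 0 := by
    simp [hH, he]
  -- Each interval passes its mass to its two halves in proportion to their contents. By
  -- subadditivity the mass never exceeds the content; if both halves have content zero so does the
  -- parent, and the quotient `0 / 0 = 0` does no harm.
  let m : ℕ → ℕ → ℝ := fun n => Nat.rec (H 0) (fun n mn k => mn (k / 2) *
    (H (n + 1) k / (H (n + 1) (2 * (k / 2)) + H (n + 1) (2 * (k / 2) + 1)))) n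
  have hm0 (k) : m 0 k = H 0 k := rfl
  have hmS (n k) : m (n + 1) k = m n (k / 2) *
    (H (n + 1) k / (H (n + 1) (2 * (k / 2)) + H (n + 1) (2 * (k / 2) + 1))) := rfl
  have hmnn (n k) : 0 ≤ m n k := by
    induction n generalizing k with
    | zero => exact hH0 0 k
    | succ n ih =>
      rw [hmS]
      exact mul_nonneg (ih _) (div_nonneg (hH0 _ _) (add_nonneg (hH0 _ _) (hH0 _ _)))
  have hmH (n k) : m n k ≤ H n k := by
    induction n generalizing k with
    | zero => exact le_rfl
    | succ n ih =>
      rw [hmS]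
      set S := H (n + 1) (2 * (k / 2)) + H (n + 1) (2 * (k / 2) + 1) with hS
      have h1 : m n (k / 2) ≤ S := (ih _).trans (hHsub _ _)
      have hS0 : 0 ≤ S := add_nonneg (hH0 _ _) (hH0 _ _)
      rcases hS0.eq_or_lt with h2 | h2
      · rw [← h2]; simpa using hH0 _ _
      · calc _ ≤ S * (H (n + 1) k / S) := by
              gcongr
          _ = _ := mul_div_cancel₀ _ h2.ne'
  have hmadd (n k) : m (n + 1) (2 * k) + m (n + 1) (2 * k + 1) = m n k := by
    rw [hmS, hmS, show 2 * k / 2 = k by omega, show (2 * k + 1) / 2 = k by omega, ← mul_add,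
      ← add_div]
    rcases eq_or_ne (H (n + 1) (2 * k) + H (n + 1) (2 * k + 1)) 0 with h1 | h1
    · have : m n k = 0 := le_antisymm (((hmH n k).trans (hHsub n k)).trans_eq h1) (hmnn n k)
      rw [this, zero_mul]
    · rw [div_self h1, mul_one]
  have hd0 : dyadicIoc 0 0 = Ioc 0 1 := by simp [dyadicIoc]
  obtain ⟨ν, hνf, hνd, hν0, hνC⟩ := exists_measure_of_dyadic_mass ht hmnn hmadd
    (fun n k => (hmH n k).trans (hHle n k)) (fun k hk => by
      rw [hm0]
      refine hHempty 0 k (eq_empty_of_forall_notMem fun x hx => ?_)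
      have h1 := hx.1.2.2
      have h2 := hx.2.1
      have h3 : (1 : ℝ) ≤ k := by exact_mod_cast hk
      simp only [pow_zero, mul_one] at h2
      linarith)
  refine ⟨ν, hνf, fun hz => ?_, ?_, hνC⟩
  · have h1 := hνd 0 0
    rw [hz, hm0, hH] at h1
    simp only [Measure.coe_zero, Pi.zero_apply] at h1
    rw [ENNReal.ofReal_toReal (hcfin 0 0), hd0, hA, inter_assoc, inter_self] at h1
    exact hcpos h1.symm
  -- A positive point outside the closed set `Z` has a dyadic interval around it missing `A`, which
  -- has no mass; there are only countably many such intervals.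
  · refine measure_mono_null (t := Iic 0 ∪ ⋃ (n : ℕ) (k : ℕ) (_ : A ∩ dyadicIoc n k = ∅),
      dyadicIoc n k) (fun x hx => ?_) (measure_union_null hν0 (measure_iUnion_null fun n =>
        measure_iUnion_null fun k => measure_iUnion_null fun he => ?_))
    · rcases le_or_gt x 0 with hx0 | hx0
      · exact Or.inl hx0
      right
      simp only [mem_iUnion, exists_prop]
      obtain ⟨ε, hε, hball⟩ := Metric.isOpen_iff.1 hZ.isOpen_compl x hx
      obtain ⟨n, hn⟩ := exists_pow_lt_of_lt_one hε (by norm_num : (1 / 2 : ℝ) < 1)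
      obtain ⟨k, hk⟩ := exists_mem_dyadicIoc hx0 n
      refine ⟨n, k, eq_empty_of_forall_notMem fun y hy => hball ?_ hy.1.1, hk⟩
      have h1 := hy.2.1
      have h2 := hy.2.2
      have h3 := hk.1
      have h4 := hk.2
      push_cast at h2 h4
      rw [Metric.mem_ball, Real.dist_eq, abs_lt]
      constructor <;> linarith
    · rw [hνd, le_antisymm ((hmH n k).trans_eq (hHempty n k he)) (hmnn n k), ENNReal.ofReal_zero]

/-- Hausdorff dimension is countably stable, so some unit piece already has dimension above `t`; it
is translated into the unit interval. -/
theorem hasCorrelation_of_lt_dimH {Z : Set ℝ} (hZ : IsClosed Z) {t : ℝ≥0} (ht0 : 0 < t)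
    (ht : (t : ℝ≥0∞) < dimH Z) : HasCorrelation Z t := by
  have h1 : Z = ⋃ k : ℤ, Z ∩ Ioc (k : ℝ) (k + 1) := by
    rw [← inter_iUnion]
    have : ⋃ k : ℤ, Ioc (k : ℝ) (k + 1) = univ := by
      exact_mod_cast iUnion_Ioc_intCast ℝ
    rw [this, inter_univ]
  rw [h1, dimH_iUnion] at ht
  obtain ⟨k, hk⟩ := lt_iSup_iff.1 ht
  have h2 : dimH ((fun x => x + (-k : ℝ)) '' (Z ∩ Ioc (k : ℝ) (k + 1))) =
      dimH (Z ∩ Ioc (k : ℝ) (k + 1)) := Isometry.dimH_image (isometry_add_right _) _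
  rw [← h2] at hk
  refine HasCorrelation.of_image_add (-k : ℝ) ?_
  refine hasCorrelation_of_hausdorffMeasure_ne_zero ?_ (by exact_mod_cast ht0) ?_
  · exact (Homeomorph.addRight (-k : ℝ)).isClosedMap _ hZ
  · have h3 := hausdorffMeasure_of_lt_dimH hk
    refine ne_of_gt (lt_of_lt_of_le (b := μH[t] ((fun x => x + (-k : ℝ)) ''
      (Z ∩ Ioc (k : ℝ) (k + 1)))) (by rw [h3]; exact ENNReal.zero_lt_top) (measure_mono ?_))
    rintro _ ⟨x, ⟨hxZ, hx1, hx2⟩, rfl⟩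
    exact ⟨⟨x, hxZ, rfl⟩, by simpa using hx1, by simp only; linarith⟩

/-! ### Tent functions and their Fourier series. -/

/-- The `1`-periodic tent function of integral one supported in the `η`-neighbourhood of `ℤ`. -/
noncomputable def tent (η x : ℝ) : ℝ :=
  (max 0 (η - Int.fract x) + max 0 (Int.fract x + η - 1)) / η ^ 2

/-- The Fourier coefficients of `tent η`. -/
noncomputable def tentCoeff (η : ℝ) (k : ℤ) : ℝ :=
  if k = 0 then 1 else (1 - Real.cos (2 * Real.pi * k * η)) / (2 * Real.pi ^ 2 * k ^ 2 * η ^ 2)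

/-- The character `x ↦ e^{2πikx}`. -/
noncomputable def expChar (k : ℤ) (x : ℝ) : ℂ := Complex.exp (2 * Real.pi * Complex.I * k * x)

theorem expChar_add (k : ℤ) (x y : ℝ) : expChar k (x + y) = expChar k x * expChar k y := by
  rw [expChar, expChar, expChar, ← Complex.exp_add]
  congr 1
  push_cast
  ring

theorem expChar_intCast (k n : ℤ) : expChar k n = 1 := by
  rw [expChar, Complex.exp_eq_one_iff]
  exact ⟨k * n, by push_cast; ring⟩

theorem norm_expChar (k : ℤ) (x : ℝ) : ‖expChar k x‖ = 1 := by
  rw [expChar, show (2 * Real.pi * Complex.I * k * x : ℂ) =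
    ((2 * Real.pi * k * x : ℝ) : ℂ) * Complex.I by push_cast; ring, Complex.norm_exp_ofReal_mul_I]

theorem expChar_add_expChar_neg (k : ℤ) (x : ℝ) :
    expChar k x + expChar k (-x) = ((2 * Real.cos (2 * Real.pi * k * x) : ℝ) : ℂ) := by
  rw [expChar, expChar, Complex.ofReal_mul, Complex.ofReal_cos, Complex.cos]
  push_cast
  rw [show (2 * Real.pi * k * x * Complex.I : ℂ) = 2 * Real.pi * Complex.I * k * x by ring,
    show (-(2 * Real.pi * k * x) * Complex.I : ℂ) = 2 * Real.pi * Complex.I * k * -x by ring]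
  ring

/-- The Fourier series of the second Bernoulli polynomial, extended periodically; the term `k = 0`
is `1 / 0 = 0`. -/
theorem hasSum_inv_sq_mul_expChar {y : ℝ} (hy : y ∈ Icc (0 : ℝ) 1) (n : ℤ) :
    HasSum (fun k : ℤ => 1 / (k : ℂ) ^ 2 * expChar k (y + n))
      ((2 * Real.pi ^ 2 * (y ^ 2 - y + 6⁻¹) : ℝ) : ℂ) := by
  have h := hasSum_one_div_pow_mul_fourier_mul_bernoulliFun (k := 2) le_rfl hy
  convert h using 1
  · ext k
    rw [fourier_coe_apply, expChar_add, expChar_intCast, expChar]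
    simp
  · rw [bernoulliFun_two]
    push_cast
    rw [mul_pow, mul_pow, Complex.I_sq, Nat.factorial_two]
    push_cast
    ring

/-- The tent is `1` minus a multiple of the second difference, with step `η`, of the periodic second
Bernoulli polynomial. The cases record whether `x - η` or `x + η` leaves the unit interval
containing `x`; `η ≤ 1 / 2` prevents both from happening strictly. -/
theorem hasSum_tent {η : ℝ} (h0 : 0 < η) (h1 : η ≤ 1 / 2) (x : ℝ) :
    HasSum (fun k : ℤ => (tentCoeff η k : ℂ) * expChar k x) (tent η x : ℂ) := by
  have hcomb {s₀ s₁ s₂ : ℝ}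
      (h₀ : HasSum (fun k : ℤ => 1 / (k : ℂ) ^ 2 * expChar k x) ((2 * Real.pi ^ 2 * s₀ : ℝ) : ℂ))
      (h₁ : HasSum (fun k : ℤ => 1 / (k : ℂ) ^ 2 * expChar k (x + η))
        ((2 * Real.pi ^ 2 * s₁ : ℝ) : ℂ))
      (h₂ : HasSum (fun k : ℤ => 1 / (k : ℂ) ^ 2 * expChar k (x - η))
        ((2 * Real.pi ^ 2 * s₂ : ℝ) : ℂ)) :
      HasSum (fun k : ℤ => (tentCoeff η k : ℂ) * expChar k x)
        ((1 + (s₀ - s₁ / 2 - s₂ / 2) / η ^ 2 : ℝ) : ℂ) := by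
    have hd : HasSum (fun k : ℤ => if k = 0 then (1 : ℂ) else 0) 1 := hasSum_ite_eq 0 1
    have := hd.add (((h₀.sub (h₁.div_const 2)).sub (h₂.div_const 2)).div_const
      ((2 * Real.pi ^ 2 * η ^ 2 : ℝ) : ℂ))
    convert this using 1
    · ext k
      rcases eq_or_ne k 0 with rfl | hk
      · simp [tentCoeff, expChar]
      · have e := expChar_add_expChar_neg k η
        have hk' : (k : ℂ) ≠ 0 := by exact_mod_cast hk
        have hη : (η : ℂ) ≠ 0 := by exact_mod_cast h0.ne'
        have hπ : (Real.pi : ℂ) ≠ 0 := by exact_mod_cast Real.pi_ne_zero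
        rw [tentCoeff, if_neg hk, if_neg hk, zero_add, sub_eq_add_neg x η, expChar_add, expChar_add]
        rw [show 1 / (k : ℂ) ^ 2 * expChar k x - 1 / (k : ℂ) ^ 2 * (expChar k x * expChar k η) / 2 -
          1 / (k : ℂ) ^ 2 * (expChar k x * expChar k (-η)) / 2 = 1 / (k : ℂ) ^ 2 * expChar k x *
            (1 - (expChar k η + expChar k (-η)) / 2) by ring, e]
        push_cast
        field_simp
    · have hη : (η : ℂ) ≠ 0 := by exact_mod_cast h0.ne'
      have hπ : (Real.pi : ℂ) ≠ 0 := by exact_mod_cast Real.pi_ne_zero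
      push_cast
      field_simp
  set u := Int.fract x with hu
  set n := ⌊x⌋ with hn
  have hx : x = u + n := (Int.fract_add_floor x).symm
  have hu0 : 0 ≤ u := Int.fract_nonneg x
  have hu1 : u < 1 := Int.fract_lt_one x
  have hS0 := hasSum_inv_sq_mul_expChar (y := u) ⟨hu0, hu1.le⟩ n
  rw [← hx] at hS0
  have hη2 : η ^ 2 ≠ 0 := by positivity
  rcases lt_or_ge u η with hc | hc
  · have hS1 := hasSum_inv_sq_mul_expChar (y := u + η) ⟨by linarith, by linarith⟩ n
    have hS2 := hasSum_inv_sq_mul_expChar (y := u - η + 1) ⟨by linarith, by linarith⟩ (n - 1)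
    rw [show u + η + n = x + η by rw [hx]; ring] at hS1
    rw [show u - η + 1 + ((n - 1 : ℤ) : ℝ) = x - η by rw [hx]; push_cast; ring] at hS2
    convert hcomb hS0 hS1 hS2 using 2
    rw [tent, ← hu, max_eq_right (by linarith), max_eq_left (by linarith)]
    field_simp
    ring
  rcases le_or_gt u (1 - η) with hc' | hc'
  · have hS1 := hasSum_inv_sq_mul_expChar (y := u + η) ⟨by linarith, by linarith⟩ n
    have hS2 := hasSum_inv_sq_mul_expChar (y := u - η) ⟨by linarith, by linarith⟩ n
    rw [show u + η + n = x + η by rw [hx]; ring] at hS1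
    rw [show u - η + n = x - η by rw [hx]; ring] at hS2
    convert hcomb hS0 hS1 hS2 using 2
    rw [tent, ← hu, max_eq_left (by linarith), max_eq_left (by linarith)]
    field_simp
    ring
  · have hS1 := hasSum_inv_sq_mul_expChar (y := u + η - 1) ⟨by linarith, by linarith⟩ (n + 1)
    have hS2 := hasSum_inv_sq_mul_expChar (y := u - η) ⟨by linarith, by linarith⟩ n
    rw [show u + η - 1 + ((n + 1 : ℤ) : ℝ) = x + η by rw [hx]; push_cast; ring] at hS1
    rw [show u - η + n = x - η by rw [hx]; ring] at hS2
    convert hcomb hS0 hS1 hS2 using 2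
    rw [tent, ← hu, max_eq_left (by linarith), max_eq_right (by linarith)]
    field_simp
    ring

theorem measurable_tent (η : ℝ) : Measurable (tent η) := by
  unfold tent
  fun_prop

theorem tent_nonneg (η x : ℝ) : 0 ≤ tent η x := by
  unfold tent
  positivity

theorem exists_int_abs_sub_le_of_tent_ne_zero {η x : ℝ} (h : tent η x ≠ 0) :
    ∃ n : ℤ, |x - n| ≤ η := by
  have h1 := Int.fract_nonneg x
  have h2 := Int.fract_lt_one x
  have h3 := Int.fract_add_floor x
  by_cases ha : Int.fract x ≤ η
  · refine ⟨⌊x⌋, ?_⟩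
    rw [abs_le]
    constructor <;> linarith
  by_cases hb : 1 - η ≤ Int.fract x
  · refine ⟨⌊x⌋ + 1, ?_⟩
    push_cast
    rw [abs_le]
    constructor <;> linarith
  · refine absurd ?_ h
    rw [tent, max_eq_left (by linarith), max_eq_left (by linarith)]
    simp

theorem tentCoeff_zero (η : ℝ) : tentCoeff η 0 = 1 := if_pos rfl

theorem tentCoeff_nonneg (η : ℝ) (k : ℤ) : 0 ≤ tentCoeff η k := by
  unfold tentCoeff
  split_ifs
  · exact zero_le_one
  · exact div_nonneg (sub_nonneg.2 (Real.cos_le_one _)) (by positivity)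

theorem tentCoeff_le_one {η : ℝ} (h0 : 0 < η) (k : ℤ) : tentCoeff η k ≤ 1 := by
  unfold tentCoeff
  split_ifs with hk
  · exact le_rfl
  · have hk' : (k : ℝ) ≠ 0 := by exact_mod_cast hk
    rw [div_le_one (by positivity)]
    have := Real.one_sub_sq_div_two_le_cos (x := 2 * Real.pi * k * η)
    nlinarith

theorem tentCoeff_le {η : ℝ} (h0 : 0 < η) {k : ℤ} (hk : k ≠ 0) :
    tentCoeff η k ≤ (1 / (|(k : ℝ)| * η)) ^ 2 := by
  have hk' : (k : ℝ) ≠ 0 := by exact_mod_cast hk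
  rw [tentCoeff, if_neg hk, div_pow, mul_pow, sq_abs, one_pow,
    div_le_div_iff₀ (by positivity) (by positivity)]
  have h1 := Real.neg_one_le_cos (2 * Real.pi * k * η)
  have h2 : 1 ≤ Real.pi ^ 2 := by nlinarith [Real.pi_gt_three]
  have h3 : (0 : ℝ) < (k : ℝ) ^ 2 * η ^ 2 := by positivity
  nlinarith

/-! ### Averaging tents over primes. -/

/-- The average of the tent functions `tent η (p x)` over the primes `p ≤ M`. -/
noncomputable def primeTent (M : ℕ) (η x : ℝ) : ℝ :=
  (∑ p ∈ Nat.primesLE M, tent η (p * x)) / (Nat.primesLE M).card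

/-- The Fourier coefficients of `primeTent M η`. -/
noncomputable def primeTentCoeff (M : ℕ) (η : ℝ) (k : ℤ) : ℝ :=
  (∑ p ∈ Nat.primesLE M, if (p : ℤ) ∣ k then tentCoeff η (k / p) else 0) / (Nat.primesLE M).card

/-- Dilation by `p` moves the spectrum to `pℤ`; this is why a frequency `k` only sees the primes
dividing it. -/
theorem hasSum_tent_mul {η : ℝ} (h0 : 0 < η) (h1 : η ≤ 1 / 2) {p : ℕ} (hp : p ≠ 0) (x : ℝ) :
    HasSum (fun k : ℤ => ((if (p : ℤ) ∣ k then tentCoeff η (k / p) else 0 : ℝ) : ℂ) * expChar k x)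
      (tent η (p * x) : ℂ) := by
  have h := hasSum_tent h0 h1 (p * x)
  have hp' : (p : ℤ) ≠ 0 := by exact_mod_cast hp
  have hinj : Function.Injective fun k : ℤ => (p : ℤ) * k := mul_right_injective₀ hp'
  rw [← hinj.hasSum_iff]
  · convert h using 1
    ext k
    simp only [Function.comp, dvd_mul_right, if_true, Int.mul_ediv_cancel_left _ hp']
    congr 1
    rw [expChar, expChar]
    congr 1
    push_cast
    ring
  · intro k hk
    rw [if_neg]
    · simp
    · rintro ⟨c, rfl⟩
      exact hk ⟨c, rfl⟩

theorem hasSum_primeTent {η : ℝ} (h0 : 0 < η) (h1 : η ≤ 1 / 2) (M : ℕ) (x : ℝ) :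
    HasSum (fun k : ℤ => (primeTentCoeff M η k : ℂ) * expChar k x) (primeTent M η x : ℂ) := by
  have h := (hasSum_sum (s := Nat.primesLE M) fun p hp => hasSum_tent_mul h0 h1
    (Nat.prime_of_mem_primesLE hp).ne_zero x).div_const ((Nat.primesLE M).card : ℂ)
  have e : (primeTent M η x : ℂ) =
      (∑ p ∈ Nat.primesLE M, (tent η (p * x) : ℂ)) / ((Nat.primesLE M).card : ℂ) := by
    simp [primeTent]
  rw [e]
  refine (congrArg (HasSum · _) (funext fun k => ?_)).mp h
  rw [← Finset.sum_mul, primeTentCoeff, Complex.ofReal_div, Complex.ofReal_sum,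
    Complex.ofReal_natCast]
  ring

theorem measurable_primeTent (M : ℕ) (η : ℝ) : Measurable (primeTent M η) := by
  unfold primeTent
  refine Measurable.div_const (Finset.measurable_sum _ fun p _ => ?_) _
  exact (measurable_tent η).comp (by fun_prop)

theorem primeTent_nonneg (M : ℕ) (η x : ℝ) : 0 ≤ primeTent M η x :=
  div_nonneg (Finset.sum_nonneg fun _ _ => tent_nonneg _ _) (Nat.cast_nonneg _)

theorem primeTentCoeff_zero {M : ℕ} (hM : 2 ≤ M) (η : ℝ) : primeTentCoeff M η 0 = 1 := by
  have : (Nat.primesLE M).card ≠ 0 :=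
    Finset.card_ne_zero_of_mem (Nat.mem_primesLE.2 ⟨hM, Nat.prime_two⟩)
  have h : ((Nat.primesLE M).card : ℝ) ≠ 0 := by exact_mod_cast this
  simp only [primeTentCoeff, dvd_zero, if_true, Int.zero_ediv, tentCoeff_zero, Finset.sum_const,
    nsmul_eq_mul, mul_one, div_self h]

theorem primeTentCoeff_nonneg (M : ℕ) (η : ℝ) (k : ℤ) : 0 ≤ primeTentCoeff M η k := by
  refine div_nonneg (Finset.sum_nonneg fun p _ => ?_) (Nat.cast_nonneg _)
  split_ifs
  · exact tentCoeff_nonneg _ _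
  · exact le_rfl

/-- The points `x` such that `p x` is `η`-close to an integer for some prime `p ≤ M`. -/
def primeNeighborhood (M : ℕ) (η : ℝ) : Set ℝ :=
  {x | ∃ p ∈ Nat.primesLE M, ∃ n : ℤ, |p * x - n| ≤ η}

theorem mem_primeNeighborhood_of_primeTent_ne_zero {M : ℕ} {η x : ℝ} (h : primeTent M η x ≠ 0) :
    x ∈ primeNeighborhood M η := by
  have h1 : ∑ p ∈ Nat.primesLE M, tent η (p * x) ≠ 0 := fun h0 => h (by simp [primeTent, h0])
  obtain ⟨p, hp, hne⟩ := Finset.exists_ne_zero_of_sum_ne_zero h1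
  exact ⟨p, hp, exists_int_abs_sub_le_of_tent_ne_zero hne⟩

theorem isClosed_primeNeighborhood (M : ℕ) {η : ℝ} (hη : 0 ≤ η) :
    IsClosed (primeNeighborhood M η) := by
  have h : primeNeighborhood M η =
      ⋃ p ∈ Nat.primesLE M, (fun x : ℝ => p * x) ⁻¹' (Metric.cthickening η (range ((↑) : ℤ → ℝ)))
      := by
    ext x
    rw [Int.isClosedEmbedding_coe_real.isClosed_range.cthickening_eq_biUnion_closedBall hη]
    simp [primeNeighborhood, Real.dist_eq]
  rw [h]
  exact Set.Finite.isClosed_biUnion (Finset.finite_toSet _) fun p _ =>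
    Metric.isClosed_cthickening.preimage (by fun_prop)

/-- The product of the distinct primes dividing `k` divides `k`, so their number is at most `log₂
|k|`, which is smaller than any power of `|k|` up to a constant. -/
theorem card_filter_dvd_le {M : ℕ} {k : ℤ} (hk : k ≠ 0) {κ : ℝ} (hκ : 0 < κ) :
    (((Nat.primesLE M).filter fun p : ℕ => (p : ℤ) ∣ k).card : ℝ) ≤
      |(k : ℝ)| ^ κ / (κ * Real.log 2) := by
  set S := (Nat.primesLE M).filter fun p : ℕ => (p : ℤ) ∣ k with hS
  have hk' : k.natAbs ≠ 0 := Int.natAbs_ne_zero.2 hk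
  have hsub : S ⊆ k.natAbs.primeFactors := by
    intro p hp
    rw [hS, Finset.mem_filter] at hp
    exact Nat.mem_primeFactors.2 ⟨Nat.prime_of_mem_primesLE hp.1, Int.natCast_dvd.1 hp.2, hk'⟩
  have h1 : 2 ^ S.card ≤ k.natAbs := by
    calc 2 ^ S.card ≤ ∏ p ∈ S, p := Finset.pow_card_le_prod _ _ _ fun p hp =>
          (Nat.prime_of_mem_primesLE (Finset.mem_filter.1 hp).1).two_le
      _ ≤ ∏ p ∈ k.natAbs.primeFactors, p := Finset.prod_le_prod_of_subset_of_one_le' hsub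
          fun p hp _ => (Nat.prime_of_mem_primeFactors hp).one_le
      _ ≤ k.natAbs := Nat.le_of_dvd (Nat.pos_of_ne_zero hk') (Nat.prod_primeFactors_dvd _)
  have h2 : (2 : ℝ) ^ S.card ≤ |(k : ℝ)| := by
    rw [← Int.cast_abs, Int.abs_eq_natAbs]
    exact_mod_cast h1
  have h3 : S.card * Real.log 2 ≤ Real.log |(k : ℝ)| := by
    rw [← Real.log_pow]
    exact Real.log_le_log (by positivity) h2
  have h4 := Real.log_le_rpow_div (abs_nonneg (k : ℝ)) hκ
  have hl : 0 < Real.log 2 := Real.log_pos one_lt_two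
  rw [← div_div, le_div_iff₀ hl]
  linarith

/-- Both size bounds for the coefficients of `primeTent`. -/
theorem primeTentCoeff_le {M : ℕ} {η : ℝ} (h0 : 0 < η) {k : ℤ} (hk : k ≠ 0) {b : ℝ}
    (hb : min 1 ((M / (|(k : ℝ)| * η)) ^ 2) ≤ b) :
    primeTentCoeff M η k ≤
      ((Nat.primesLE M).filter fun p : ℕ => (p : ℤ) ∣ k).card * b / (Nat.primesLE M).card := by
  refine div_le_div_of_nonneg_right ?_ (Nat.cast_nonneg _)
  rw [← Finset.sum_filter, ← nsmul_eq_mul]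
  refine Finset.sum_le_card_nsmul _ _ _ fun p hp => le_trans (le_min (tentCoeff_le_one h0 _) ?_) hb
  obtain ⟨hpM, c, rfl⟩ := Finset.mem_filter.1 hp
  have hp0 := (Nat.prime_of_mem_primesLE hpM).pos
  have hp' : (0 : ℝ) < p := by exact_mod_cast hp0
  have hc : c ≠ 0 := by rintro rfl; simp at hk
  have hc' : (0 : ℝ) < |(c : ℝ)| := abs_pos.2 (by exact_mod_cast hc)
  rw [Int.mul_ediv_cancel_left _ (by exact_mod_cast hp0.ne')]
  refine (tentCoeff_le h0 hc).trans ?_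
  push_cast
  rw [abs_mul, Nat.abs_cast]
  have hpM' : (p : ℝ) ≤ M := by exact_mod_cast Nat.le_of_mem_primesLE hpM
  gcongr ?_ ^ 2
  rw [div_le_div_iff₀ (by positivity) (by positivity)]
  calc 1 * (p * |(c : ℝ)| * η) = p * (|(c : ℝ)| * η) := by ring
    _ ≤ _ := by gcongr

/-- Chebyshev's lower bound, with the logarithm absorbed by `M ^ (1 - q)`. -/
theorem eventually_rpow_le_primeCounting {q : ℝ} (hq : q < 1) :
    ∀ᶠ M : ℕ in Filter.atTop, (M : ℝ) ^ q ≤ (Nat.primesLE M).card := by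
  have h1 : ∀ᶠ M : ℕ in Filter.atTop, ‖Real.log (M : ℝ)‖ ≤ 1 / 4 * ‖(M : ℝ) ^ (1 - q)‖ :=
    tendsto_natCast_atTop_atTop.eventually
      ((isLittleO_log_rpow_atTop (by linarith : 0 < 1 - q)).def (by norm_num : (0 : ℝ) < 1 / 4))
  have h2 : ∀ᶠ M : ℕ in Filter.atTop, ‖Real.log ((M + 1 : ℕ) : ℝ)‖ ≤
      1 / 8 * ‖((M + 1 : ℕ) : ℝ) ^ (1 : ℝ)‖ :=
    (tendsto_natCast_atTop_atTop.comp (Filter.tendsto_add_atTop_nat 1)).eventually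
      ((isLittleO_log_rpow_atTop one_pos).def (by norm_num : (0 : ℝ) < 1 / 8))
  filter_upwards [h1, h2, Filter.eventually_ge_atTop 2] with M h1 h2 hM
  have hM' : (2 : ℝ) ≤ M := by exact_mod_cast hM
  have hlog : 0 < Real.log M := Real.log_pos (by linarith)
  have hpi := Chebyshev.pi_ge M
  rw [← Nat.primesLE_card_eq_primeCounting] at hpi
  refine le_trans ?_ hpi
  rw [le_div_iff₀ hlog]
  rw [Real.norm_of_nonneg hlog.le, Real.norm_of_nonneg (by positivity)] at h1
  push_cast at h2
  rw [Real.rpow_one, Real.norm_of_nonneg (Real.log_nonneg (by linarith)),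
    Real.norm_of_nonneg (by positivity)] at h2
  have h3 : (M : ℝ) ^ q * Real.log M ≤ 1 / 4 * M := by
    calc _ ≤ (M : ℝ) ^ q * (1 / 4 * (M : ℝ) ^ (1 - q)) := by gcongr
      _ = 1 / 4 * ((M : ℝ) ^ q * (M : ℝ) ^ (1 - q)) := by ring
      _ = 1 / 4 * M := by rw [← Real.rpow_add (by linarith), add_sub_cancel, Real.rpow_one]
  have h4 := Real.log_two_gt_d9
  nlinarith

/-- For `η = M ^ (1 - 2 / α)` the nonzero Fourier coefficients of `primeTent M η` are eventually
smaller than any multiple of `(1 + |k|) ^ (-γ)`, for each `γ < α / 2`. -/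
theorem eventually_primeTentCoeff_le {α γ ε : ℝ} (hα0 : 0 < α) (hα1 : α < 1) (hγ0 : 0 ≤ γ)
    (hγ : γ < α / 2) (hε : 0 < ε) :
    ∀ᶠ M : ℕ in Filter.atTop, ∀ k : ℤ, k ≠ 0 →
      primeTentCoeff M ((M : ℝ) ^ (1 - 2 / α)) k ≤ ε * (1 + |(k : ℝ)|) ^ (-γ) := by
  -- Half of the gap pays for the divisor count `|k| ^ κ`. The coefficient is then at most a
  -- constant times `M ^ q * |k| ^ (-γ)` divided by the number of primes; as `q < 1`, that number
  -- exceeds `M ^ q'` with `q'` midway to `1`.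
  set κ := (α / 2 - γ) / 2 with hκ
  have hκ0 : 0 < κ := by linarith
  set q := 2 / α * (γ + κ) with hq
  have hq1 : q < 1 := by
    rw [hq, div_mul_eq_mul_div, div_lt_one hα0]
    linarith
  set q' := (1 + q) / 2 with hq'
  have hl : 0 < Real.log 2 := Real.log_pos one_lt_two
  have hlim : Filter.Tendsto (fun M : ℕ => (M : ℝ) ^ (-(q' - q)) * (2 ^ γ / (κ * Real.log 2)))
      Filter.atTop (nhds 0) := by
    have := ((tendsto_rpow_neg_atTop (by linarith : 0 < q' - q)).comp
      tendsto_natCast_atTop_atTop).mul_const (2 ^ γ / (κ * Real.log 2))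
    rwa [zero_mul] at this
  filter_upwards [eventually_rpow_le_primeCounting (by linarith : q' < 1),
    hlim.eventually_le_const hε, Filter.eventually_ge_atTop 2] with M hM1 hM2 hM k hk
  have hM' : (0 : ℝ) < M := by
    have : (2 : ℝ) ≤ M := by exact_mod_cast hM
    linarith
  have hη : 0 < (M : ℝ) ^ (1 - 2 / α) := Real.rpow_pos_of_pos hM' _
  have hk1 : 1 ≤ |(k : ℝ)| := by
    rw [← Int.cast_abs]
    exact_mod_cast Int.one_le_abs hk
  set x := |(k : ℝ)| with hx
  have hx0 : 0 < x := by linarith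
  have hX : (M : ℝ) / (x * (M : ℝ) ^ (1 - 2 / α)) = (M : ℝ) ^ (2 / α) / x := by
    rw [Real.rpow_sub hM', Real.rpow_one]
    field_simp
  set y := (M : ℝ) ^ (2 / α) / x with hy
  have hy0 : 0 < y := by positivity
  -- The minimum of `1` and `y ^ 2` lies below every power `y ^ θ` with `0 ≤ θ ≤ 2`.
  have hmin : min 1 (((M : ℝ) / (x * (M : ℝ) ^ (1 - 2 / α))) ^ 2) ≤ y ^ (κ + γ) := by
    rw [hX]
    rcases le_total 1 y with h | h
    · exact (min_le_left _ _).trans (Real.one_le_rpow h (by linarith))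
    · refine (min_le_right _ _).trans ?_
      rw [← Real.rpow_two]
      exact Real.rpow_le_rpow_of_exponent_ge hy0 h (by linarith)
  refine (primeTentCoeff_le hη hk hmin).trans ?_
  calc _ ≤ (x ^ κ / (κ * Real.log 2)) * y ^ (κ + γ) / (M : ℝ) ^ q' := by
        gcongr
        exact card_filter_dvd_le hk hκ0
    _ = (M : ℝ) ^ (-(q' - q)) * (1 / (κ * Real.log 2)) * x ^ (-γ) := by
        rw [hy, Real.div_rpow (by positivity) hx0.le, ← Real.rpow_mul hM'.le,
          Real.rpow_add hx0, Real.rpow_neg hx0.le, neg_sub, Real.rpow_sub hM',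
          show 2 / α * (κ + γ) = q by rw [hq, add_comm]]
        have h1 : x ^ κ ≠ 0 := (Real.rpow_pos_of_pos hx0 _).ne'
        have h2 : x ^ γ ≠ 0 := (Real.rpow_pos_of_pos hx0 _).ne'
        field_simp
    _ ≤ (M : ℝ) ^ (-(q' - q)) * (1 / (κ * Real.log 2)) * (2 ^ γ * (1 + x) ^ (-γ)) := by
        gcongr
        rw [Real.rpow_neg hx0.le, Real.rpow_neg (by positivity), ← div_eq_mul_inv,
          ← Real.div_rpow (by norm_num) (by positivity), ← Real.inv_rpow hx0.le]
        gcongr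
        rw [inv_eq_one_div, div_le_div_iff₀ hx0 (by positivity)]
        linarith
    _ = ((M : ℝ) ^ (-(q' - q)) * (2 ^ γ / (κ * Real.log 2))) * (1 + x) ^ (-γ) := by ring
    _ ≤ ε * (1 + x) ^ (-γ) := by gcongr

/-! ### Multiplying measures by Fourier series. -/

/-- Uniform bound for the sums `∑ₖ (1 + |ξ - k|) ^ (-3/2)`. -/
theorem exists_tsum_translate_le : ∃ W : ℝ, 0 < W ∧ ∀ ξ : ℝ,
    Summable (fun k : ℤ => (1 + |ξ - k|) ^ (-(3 / 2 : ℝ))) ∧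
    ∑' k : ℤ, (1 + |ξ - k|) ^ (-(3 / 2 : ℝ)) ≤ W := by
  set g : ℤ → ℝ := fun k => 2 ^ (3 / 2 : ℝ) * (1 / |(k : ℝ) + 1 / 2| ^ (3 / 2 : ℝ)) with hg
  have hgs : Summable g :=
    ((Real.summable_one_div_int_add_rpow (1 / 2) (3 / 2)).2 (by norm_num)).mul_left _
  have hk0 (k : ℤ) : 0 < |(k : ℝ) + 1 / 2| := by
    refine abs_pos.2 fun h => ?_
    have h1 : ((2 * k + 1 : ℤ) : ℝ) = 0 := by push_cast; linarith
    have h2 : 2 * k + 1 = 0 := by exact_mod_cast h1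
    omega
  have hg0 (k : ℤ) : 0 ≤ g k := by positivity
  refine ⟨∑' k, g k + 1, by linarith [show 0 ≤ ∑' k, g k from tsum_nonneg hg0], fun ξ => ?_⟩
  set n := ⌊ξ⌋ with hn
  set f : ℤ → ℝ := fun k => (1 + |ξ - k|) ^ (-(3 / 2 : ℝ)) with hf
  have hle (k : ℤ) : f (k + n) ≤ g k := by
    simp only [hf, hg]
    have h1 := Int.fract_nonneg ξ
    have h2 := Int.fract_lt_one ξ
    have h3 : Int.fract ξ = ξ - n := rfl
    have h4 : |(k : ℝ) + 1 / 2| / 2 ≤ 1 + |ξ - (k + n : ℤ)| := by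
      have : |(k : ℝ) + 1 / 2| ≤ |ξ - (k + n : ℤ)| + 3 / 2 := by
        calc |(k : ℝ) + 1 / 2| = |-(ξ - (k + n : ℤ)) + (Int.fract ξ + 1 / 2)| := by
              congr 1
              push_cast
              linarith
          _ ≤ |-(ξ - (k + n : ℤ))| + |Int.fract ξ + 1 / 2| := abs_add_le _ _
          _ ≤ _ := by
              rw [abs_neg, abs_of_nonneg (by linarith : 0 ≤ Int.fract ξ + 1 / 2)]
              linarith
      linarith [abs_nonneg (ξ - (k + n : ℤ))]
    refine (Real.rpow_le_rpow_of_nonpos (by linarith [hk0 k]) h4 (by norm_num)).trans_eq ?_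
    rw [Real.rpow_neg (by positivity), Real.div_rpow (by positivity) (by norm_num), inv_div,
      div_eq_mul_one_div]
  have hs : Summable fun k : ℤ => f (k + n) :=
    Summable.of_nonneg_of_le (fun k => by positivity) hle hgs
  have hs' : Summable f := (Equiv.addRight n).summable_iff.1 hs
  refine ⟨hs', ?_⟩
  have : ∑' k, f k = ∑' k, f (k + n) := ((Equiv.addRight n).tsum_eq f).symm
  rw [this]
  linarith [hs.tsum_le_tsum hle hgs]

/-- Peetre's inequality. -/
theorem one_add_abs_le_mul (ξ k : ℝ) : 1 + |ξ| ≤ (1 + |k|) * (1 + |ξ - k|) := by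
  have h : |ξ| ≤ |k| + |ξ - k| := by
    calc |ξ| = |k + (ξ - k)| := by congr 1; ring
      _ ≤ _ := abs_add_le _ _
  nlinarith [abs_nonneg k, abs_nonneg (ξ - k)]

theorem sq_one_add_abs_le (ξ k : ℝ) :
    (1 + |ξ|) ^ 2 ≤ 2 * (1 + |k|) ^ 2 + 2 * (1 + |ξ - k|) ^ 2 := by
  have h : |ξ| ≤ |k| + |ξ - k| := by
    calc |ξ| = |k + (ξ - k)| := by congr 1; ring
      _ ≤ _ := abs_add_le _ _
  nlinarith [abs_nonneg k, abs_nonneg (ξ - k), abs_nonneg ξ, sq_nonneg (|k| - |ξ - k|)]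

/-- Multiplying a measure by a nonnegative function with absolutely convergent Fourier series. -/
theorem hasSum_measureFourier_withDensity (ρ : Measure ℝ) [IsFiniteMeasure ρ] {F : ℝ → ℝ}
    (hFm : Measurable F) (hF0 : ∀ x, 0 ≤ F x) {a : ℤ → ℝ} (ha : Summable fun k => |a k|)
    (hF : ∀ x, HasSum (fun k : ℤ => (a k : ℂ) * expChar k x) (F x : ℂ)) (ξ : ℝ) :
    HasSum (fun k : ℤ => (a k : ℂ) * measureFourier ρ (ξ - k))
      (measureFourier (ρ.withDensity fun x => ENNReal.ofReal (F x)) ξ) := by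
  have hint : measureFourier (ρ.withDensity fun x => ENNReal.ofReal (F x)) ξ =
      ∫ x, ∑' k : ℤ, (a k : ℂ) * Complex.exp (-2 * Real.pi * Complex.I * x * (ξ - k : ℝ)) ∂ρ := by
    rw [measureFourier, integral_withDensity_eq_integral_toReal_smul (by fun_prop)
      (Filter.Eventually.of_forall fun x => ENNReal.ofReal_lt_top)]
    refine integral_congr_ae (Filter.Eventually.of_forall fun x => ?_)
    simp only
    rw [ENNReal.toReal_ofReal (hF0 x), Complex.real_smul, ← (hF x).tsum_eq, ← tsum_mul_right]
    congr 1
    ext k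
    rw [expChar, mul_assoc, ← Complex.exp_add]
    congr 2
    push_cast
    ring
  rw [hint]
  have hnorm (k : ℤ) (x : ℝ) : ‖(a k : ℂ) *
      Complex.exp (-2 * Real.pi * Complex.I * x * (ξ - k : ℝ))‖ = |a k| := by
    rw [norm_mul, norm_exp_measureFourier_kernel, mul_one, Complex.norm_real, Real.norm_eq_abs]
  have := hasSum_integral_of_summable_integral_norm (μ := ρ)
    (F := fun (k : ℤ) (x : ℝ) =>
      (a k : ℂ) * Complex.exp (-2 * Real.pi * Complex.I * x * (ξ - k : ℝ))) (fun k => ?_) ?_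
  · simp only [integral_const_mul] at this
    exact this
  · refine (integrable_const |a k|).mono' ?_ (Filter.Eventually.of_forall fun x => (hnorm k x).le)
    apply Measurable.aestronglyMeasurable
    fun_prop
  · simp only [hnorm, integral_const, smul_eq_mul]
    exact ha.mul_left _

/-- Finite measures on `[0, 2]` whose Fourier transform is `O(|ξ|⁻²)`. -/
def IsSmoothOnInterval (ρ : Measure ℝ) : Prop :=
  IsFiniteMeasure ρ ∧ ρ (Icc 0 2)ᶜ = 0 ∧
    ∃ B : ℝ, ∀ ξ : ℝ, ‖measureFourier ρ ξ‖ ≤ B * ((1 + |ξ|) ^ 2)⁻¹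

theorem norm_measureFourier_unitInterval_le (ξ : ℝ) :
    ‖measureFourier (volume.restrict (Icc (0 : ℝ) 1)) ξ‖ ≤ 2 * (1 + |ξ|)⁻¹ := by
  have : IsProbabilityMeasure (volume.restrict (Icc (0 : ℝ) 1)) := ⟨by simp⟩
  have h1 : ‖measureFourier (volume.restrict (Icc (0 : ℝ) 1)) ξ‖ ≤ 1 := by
    simpa using norm_measureFourier_le (volume.restrict (Icc (0 : ℝ) 1)) ξ
  rcases le_or_gt |ξ| 1 with h | h
  · refine h1.trans ?_
    rw [← div_eq_mul_inv, le_div_iff₀ (by positivity)]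
    linarith
  have hξ : ξ ≠ 0 := by rintro rfl; simp at h; linarith
  have hc : (-2 * Real.pi * Complex.I * ξ : ℂ) ≠ 0 := by
    simp [Real.pi_ne_zero, hξ]
  have h2 : measureFourier (volume.restrict (Icc (0 : ℝ) 1)) ξ =
      (Complex.exp (-2 * Real.pi * Complex.I * ξ) - 1) / (-2 * Real.pi * Complex.I * ξ) := by
    rw [measureFourier, integral_Icc_eq_integral_Ioc, ← intervalIntegral.integral_of_le zero_le_one]
    have := integral_exp_mul_complex (a := 0) (b := 1) hc
    simp only [Complex.ofReal_zero, mul_zero, Complex.exp_zero, Complex.ofReal_one, mul_one] at this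
    rw [← this]
    refine intervalIntegral.integral_congr fun x _ => ?_
    congr 1
    ring
  have h3 : ‖Complex.exp (-2 * Real.pi * Complex.I * ξ) - 1‖ ≤ 2 := by
    refine (norm_sub_le _ _).trans ?_
    have := norm_exp_measureFourier_kernel 1 ξ
    rw [Complex.ofReal_one, mul_one] at this
    rw [this, norm_one]
    norm_num
  have h4 : ‖(-2 * Real.pi * Complex.I * ξ : ℂ)‖ = 2 * Real.pi * |ξ| := by
    simp [abs_of_pos Real.pi_pos]
  rw [h2, norm_div, h4, ← div_eq_mul_inv, div_le_div_iff₀ (by positivity) (by positivity)]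
  nlinarith [Real.pi_gt_three]

/-- The convolution square of Lebesgue measure on `[0, 1]`: its transform is the square of one that
is `O(1 / |ξ|)`. -/
theorem exists_isSmoothOnInterval : ∃ ρ : Measure ℝ, IsSmoothOnInterval ρ ∧ ρ univ = 1 := by
  set τ := volume.restrict (Icc (0 : ℝ) 1) with hτ
  have : IsProbabilityMeasure τ := ⟨by simp [hτ]⟩
  have hm : Measurable fun p : ℝ × ℝ => p.1 + p.2 := by fun_prop
  have : IsProbabilityMeasure ((τ.prod τ).map fun p => p.1 + p.2) :=
    Measure.isProbabilityMeasure_map hm.aemeasurable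
  refine ⟨(τ.prod τ).map fun p => p.1 + p.2, ⟨inferInstance, ?_, 4, fun ξ => ?_⟩, measure_univ⟩
  · rw [Measure.map_apply hm measurableSet_Icc.compl]
    refine measure_eq_zero_iff_ae_notMem.2 ?_
    have h1 : ∀ᵐ x ∂τ, x ∈ Icc (0 : ℝ) 1 := ae_restrict_mem measurableSet_Icc
    filter_upwards [Measure.quasiMeasurePreserving_fst.ae h1,
      Measure.quasiMeasurePreserving_snd.ae h1] with p hp1 hp2 hmem
    exact hmem ⟨by linarith [hp1.1, hp2.1], by linarith [hp1.2, hp2.2]⟩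
  · have h : measureFourier ((τ.prod τ).map fun p => p.1 + p.2) ξ = measureFourier τ ξ ^ 2 := by
      rw [measureFourier, integral_map hm.aemeasurable
        (Measurable.aestronglyMeasurable (by fun_prop)), sq, measureFourier, ← integral_prod_mul]
      refine integral_congr_ae (Filter.Eventually.of_forall fun p => ?_)
      simp only
      rw [← Complex.exp_add]
      congr 1
      push_cast
      ring
    rw [h, norm_pow]
    calc _ ≤ (2 * (1 + |ξ|)⁻¹) ^ 2 := by
          gcongr
          exact norm_measureFourier_unitInterval_le ξ
      _ = _ := by rw [mul_pow, inv_pow]; norm_num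

/-- Quadratic decay survives convolution with quadratically decaying coefficients, because one of
`k` and `ξ - k` is comparable to `ξ` or larger. The construction can therefore be iterated; no
uniformity of the constants is needed. -/
theorem IsSmoothOnInterval.withDensity {ρ : Measure ℝ} (hρ : IsSmoothOnInterval ρ) {F : ℝ → ℝ}
    (hFm : Measurable F) (hF0 : ∀ x, 0 ≤ F x) {a : ℤ → ℝ} {A : ℝ}
    (haA : ∀ k : ℤ, |a k| ≤ A * ((1 + |(k : ℝ)|) ^ 2)⁻¹)
    (hF : ∀ x, HasSum (fun k : ℤ => (a k : ℂ) * expChar k x) (F x : ℂ)) :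
    (Summable fun k => |a k|) ∧
      IsSmoothOnInterval (ρ.withDensity fun x => ENNReal.ofReal (F x)) := by
  obtain ⟨W, hW, hWs⟩ := exists_tsum_translate_le
  have hle (x : ℝ) : ((1 + |x|) ^ 2)⁻¹ ≤ (1 + |x|) ^ (-(3 / 2 : ℝ)) := by
    rw [← Real.rpow_natCast, ← Real.rpow_neg (by positivity)]
    exact Real.rpow_le_rpow_of_exponent_le (by linarith [abs_nonneg x]) (by norm_num)
  have hA0 : 0 ≤ A := by
    have := (abs_nonneg _).trans (haA 0)
    simpa using this
  have hs (ξ : ℝ) : Summable fun k : ℤ => ((1 + |ξ - k|) ^ 2)⁻¹ :=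
    Summable.of_nonneg_of_le (fun k => by positivity) (fun k => hle _) (hWs ξ).1
  have hsW (ξ : ℝ) : ∑' k : ℤ, ((1 + |ξ - k|) ^ 2)⁻¹ ≤ W :=
    ((hs ξ).tsum_le_tsum (fun k => hle _) (hWs ξ).1).trans (hWs ξ).2
  have ha : Summable fun k => |a k| := by
    refine Summable.of_nonneg_of_le (fun k => abs_nonneg _) haA (Summable.mul_left _ ?_)
    simpa using hs 0
  refine ⟨ha, ?_⟩
  obtain ⟨hfin, hsupp, B, hB⟩ := hρ
  have hB0 : 0 ≤ B := by
    have := (norm_nonneg _).trans (hB 0)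
    simpa using this
  have hFb (x : ℝ) : F x ≤ ∑' k, |a k| := by
    have h1 : ‖(F x : ℂ)‖ ≤ ∑' k, |a k| := by
      rw [← (hF x).tsum_eq]
      refine tsum_of_norm_bounded ha.hasSum fun k => ?_
      rw [norm_mul, norm_expChar, mul_one, Complex.norm_real, Real.norm_eq_abs]
    rw [Complex.norm_real] at h1
    exact (le_abs_self _).trans h1
  have hFi : Integrable F ρ := (integrable_const (∑' k, |a k|)).mono' hFm.aestronglyMeasurable
    (Filter.Eventually.of_forall fun x => by rw [Real.norm_of_nonneg (hF0 x)]; exact hFb x)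
  refine ⟨isFiniteMeasure_withDensity_ofReal hFi.2, withDensity_absolutelyContinuous _ _ hsupp,
    2 * A * B * W + 2 * B * ∑' k, |a k|, fun ξ => ?_⟩
  have hsum := hasSum_measureFourier_withDensity ρ hFm hF0 ha hF ξ
  rw [← div_eq_mul_inv, le_div_iff₀ (by positivity), ← hsum.tsum_eq]
  have hterm (k : ℤ) : ‖((1 + |ξ|) ^ 2 : ℝ) * ((a k : ℂ) * measureFourier ρ (ξ - k))‖ ≤
      2 * A * B * ((1 + |ξ - k|) ^ 2)⁻¹ + 2 * B * |a k| := by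
    rw [norm_mul, norm_mul, Complex.norm_real, Complex.norm_real,
      Real.norm_of_nonneg (by positivity : 0 ≤ (1 + |ξ|) ^ 2), Real.norm_eq_abs]
    have h1 : (0 : ℝ) < (1 + |(k : ℝ)|) ^ 2 := by positivity
    have h2 : (0 : ℝ) < (1 + |ξ - k|) ^ 2 := by positivity
    have h3 := haA k
    have h4 := hB (ξ - k)
    rw [← div_eq_mul_inv, le_div_iff₀ h1] at h3
    have h5 : ‖measureFourier ρ (ξ - k)‖ * (1 + |ξ - k|) ^ 2 ≤ B := by
      rwa [← div_eq_mul_inv, le_div_iff₀ h2] at h4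
    calc _ ≤ (2 * (1 + |(k : ℝ)|) ^ 2 + 2 * (1 + |ξ - k|) ^ 2) *
          (|a k| * ‖measureFourier ρ (ξ - k)‖) := by
          gcongr
          exact sq_one_add_abs_le ξ k
      _ = 2 * (|a k| * (1 + |(k : ℝ)|) ^ 2) * ‖measureFourier ρ (ξ - k)‖ +
          2 * |a k| * (‖measureFourier ρ (ξ - k)‖ * (1 + |ξ - k|) ^ 2) := by ring
      _ ≤ 2 * A * (B * ((1 + |ξ - k|) ^ 2)⁻¹) + 2 * |a k| * B := by gcongr
      _ = _ := by ring
  have hbound : Summable fun k : ℤ => 2 * A * B * ((1 + |ξ - k|) ^ 2)⁻¹ + 2 * B * |a k| :=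
    ((hs ξ).mul_left _).add (ha.mul_left _)
  calc _ = ‖∑' k : ℤ, ((1 + |ξ|) ^ 2 : ℝ) * ((a k : ℂ) * measureFourier ρ (ξ - k))‖ := by
        rw [tsum_mul_left, norm_mul, Complex.norm_real, Real.norm_of_nonneg (by positivity),
          mul_comm]
    _ ≤ ∑' k : ℤ, (2 * A * B * ((1 + |ξ - k|) ^ 2)⁻¹ + 2 * B * |a k|) :=
        tsum_of_norm_bounded hbound.hasSum hterm
    _ = 2 * A * B * ∑' k : ℤ, ((1 + |ξ - k|) ^ 2)⁻¹ + 2 * B * ∑' k, |a k| := by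
        rw [((hs ξ).mul_left _).tsum_add (ha.mul_left _), tsum_mul_left, tsum_mul_left]
    _ ≤ _ := by
        have := hsW ξ
        gcongr

/-- The term `k = 0` reproduces the transform of `ρ`. In the others Peetre's inequality trades `(1 +
|k|) ^ (-γ)` for `(1 + |ξ|) ^ (-γ)` at the cost of `(1 + |ξ - k|) ^ γ`; as `γ ≤ 1 / 2`, the
quadratic decay of `ρ` pays for this and leaves the summable exponent `-3/2`. -/
theorem norm_measureFourier_withDensity_sub_le {ρ : Measure ℝ} [IsFiniteMeasure ρ] {B : ℝ}
    (hB0 : 0 ≤ B) (hB : ∀ ξ : ℝ, ‖measureFourier ρ ξ‖ ≤ B * ((1 + |ξ|) ^ 2)⁻¹) {W : ℝ}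
    (hW : ∀ ξ : ℝ, Summable (fun k : ℤ => (1 + |ξ - k|) ^ (-(3 / 2 : ℝ))) ∧
      ∑' k : ℤ, (1 + |ξ - k|) ^ (-(3 / 2 : ℝ)) ≤ W) {F : ℝ → ℝ}
    (hFm : Measurable F) (hF0 : ∀ x, 0 ≤ F x) {a : ℤ → ℝ} (ha : Summable fun k => |a k|)
    (hF : ∀ x, HasSum (fun k : ℤ => (a k : ℂ) * expChar k x) (F x : ℂ)) (ha0 : a 0 = 1)
    {γ ε : ℝ} (hγ0 : 0 ≤ γ) (hγ : γ ≤ 1 / 2) (hε : 0 ≤ ε)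
    (haε : ∀ k : ℤ, k ≠ 0 → |a k| ≤ ε * (1 + |(k : ℝ)|) ^ (-γ)) (ξ : ℝ) :
    ‖measureFourier (ρ.withDensity fun x => ENNReal.ofReal (F x)) ξ - measureFourier ρ ξ‖ ≤
      ε * B * W * (1 + |ξ|) ^ (-γ) := by
  have hsum := hasSum_measureFourier_withDensity ρ hFm hF0 ha hF ξ
  have hd : HasSum (fun k : ℤ => if k = 0 then measureFourier ρ ξ else 0) (measureFourier ρ ξ) :=
    hasSum_ite_eq 0 _
  have hdiff := hsum.sub hd
  rw [← hdiff.tsum_eq]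
  have hbound : Summable fun k : ℤ => ε * B * (1 + |ξ|) ^ (-γ) * (1 + |ξ - k|) ^ (-(3 / 2 : ℝ)) :=
    (hW ξ).1.mul_left _
  refine (tsum_of_norm_bounded hbound.hasSum fun k => ?_).trans ?_
  · rcases eq_or_ne k 0 with rfl | hk
    · simp only [ha0, if_true, Int.cast_zero, sub_zero, Complex.ofReal_one, one_mul, sub_self,
        norm_zero]
      positivity
    · rw [if_neg hk, sub_zero, norm_mul, Complex.norm_real, Real.norm_eq_abs]
      have hp : (1 + |(k : ℝ)|) ^ (-γ) * (1 + |ξ - k|) ^ (-γ) ≤ (1 + |ξ|) ^ (-γ) := by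
        rw [← Real.mul_rpow (by positivity) (by positivity)]
        exact Real.rpow_le_rpow_of_nonpos (by positivity) (one_add_abs_le_mul ξ k) (by linarith)
      have hq : ((1 + |ξ - k|) ^ 2)⁻¹ ≤ (1 + |ξ - k|) ^ (-γ) * (1 + |ξ - k|) ^ (-(3 / 2 : ℝ)) := by
        rw [← Real.rpow_natCast, ← Real.rpow_neg (by positivity), ← Real.rpow_add (by positivity)]
        refine Real.rpow_le_rpow_of_exponent_le (by linarith [abs_nonneg (ξ - k)]) ?_
        push_cast
        linarith
      calc _ ≤ ε * (1 + |(k : ℝ)|) ^ (-γ) * (B * ((1 + |ξ - k|) ^ 2)⁻¹) := by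
            gcongr
            · exact haε k hk
            · exact hB _
        _ ≤ ε * (1 + |(k : ℝ)|) ^ (-γ) *
            (B * ((1 + |ξ - k|) ^ (-γ) * (1 + |ξ - k|) ^ (-(3 / 2 : ℝ)))) := by gcongr
        _ = ε * B * ((1 + |(k : ℝ)|) ^ (-γ) * (1 + |ξ - k|) ^ (-γ)) *
            (1 + |ξ - k|) ^ (-(3 / 2 : ℝ)) := by ring
        _ ≤ _ := by gcongr
  · rw [tsum_mul_left]
    calc _ ≤ ε * B * (1 + |ξ|) ^ (-γ) * W := by
          gcongr
          exact (hW ξ).2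
      _ = _ := by ring

/-- A crude bound with a constant depending on `M` and `η`, used only for summability and to stay in
the smooth class. -/
theorem primeTentCoeff_le_mul_inv {M : ℕ} (hM : 2 ≤ M) {η : ℝ} (hη : 0 < η) (k : ℤ) :
    |primeTentCoeff M η k| ≤ (1 + 4 * (M / η) ^ 2) * ((1 + |(k : ℝ)|) ^ 2)⁻¹ := by
  rw [abs_of_nonneg (primeTentCoeff_nonneg M η k)]
  rcases eq_or_ne k 0 with rfl | hk
  · rw [primeTentCoeff_zero hM]
    simp
    positivity
  have hk1 : 1 ≤ |(k : ℝ)| := by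
    rw [← Int.cast_abs]
    exact_mod_cast Int.one_le_abs hk
  refine (primeTentCoeff_le hη hk (min_le_right _ _)).trans ?_
  set b := ((M : ℝ) / (|(k : ℝ)| * η)) ^ 2 with hb
  have hc : (((Nat.primesLE M).filter fun p : ℕ => (p : ℤ) ∣ k).card : ℝ) ≤
      (Nat.primesLE M).card := by
    exact_mod_cast Finset.card_filter_le _ _
  calc _ ≤ ((Nat.primesLE M).card : ℝ) * b / (Nat.primesLE M).card := by gcongr
    _ ≤ b := by
        rw [mul_div_assoc, mul_comm, div_mul_eq_mul_div, mul_div_assoc]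
        exact mul_le_of_le_one_right (by positivity) (div_self_le_one _)
    _ = (M / η) ^ 2 / |(k : ℝ)| ^ 2 := by rw [hb, ← div_pow, div_div, mul_comm]
    _ ≤ (1 + 4 * (M / η) ^ 2) * ((1 + |(k : ℝ)|) ^ 2)⁻¹ := by
        rw [← div_eq_mul_inv, div_le_div_iff₀ (by positivity) (by positivity)]
        have h1 : (1 + |(k : ℝ)|) ^ 2 ≤ 4 * |(k : ℝ)| ^ 2 := by nlinarith
        have h2 : (0 : ℝ) ≤ (M / η) ^ 2 := by positivity
        have h3 : (0 : ℝ) ≤ |(k : ℝ)| ^ 2 := by positivity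
        nlinarith

/-! ### Construction of Salem sets. -/

/-- The scale `η = M ^ (1 - 2 / α)`. -/
noncomputable def salemScale (α : ℝ) (M : ℕ) : ℝ := (M : ℝ) ^ (1 - 2 / α)

theorem salemScale_pos (α : ℝ) {M : ℕ} (hM : 2 ≤ M) : 0 < salemScale α M :=
  Real.rpow_pos_of_pos (by exact_mod_cast (by omega : 0 < M)) _

theorem salemScale_le_half {α : ℝ} (hα0 : 0 < α) (hα1 : α < 1) {M : ℕ} (hM : 2 ≤ M) :
    salemScale α M ≤ 1 / 2 := by
  have hM' : (2 : ℝ) ≤ M := by exact_mod_cast hM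
  have h2 : 2 < 2 / α := by rw [lt_div_iff₀ hα0]; linarith
  calc salemScale α M ≤ (M : ℝ) ^ (-1 : ℝ) :=
        Real.rpow_le_rpow_of_exponent_le (by linarith) (by linarith)
    _ = 1 / M := by rw [Real.rpow_neg_one, one_div]
    _ ≤ 1 / 2 := by gcongr

/-- One step of the construction: sieve `ρ` by a prime neighbourhood while changing its Fourier
transform by as little as `δ (1 + |ξ|) ^ (-γ)`. -/
theorem IsSmoothOnInterval.exists_step {α γ δ : ℝ} (hα0 : 0 < α) (hα1 : α < 1) (hγ0 : 0 ≤ γ)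
    (hγ : γ < α / 2) (hδ : 0 < δ) {ρ : Measure ℝ} (hρ : IsSmoothOnInterval ρ) (N : ℕ) :
    ∃ ρ' : Measure ℝ, IsSmoothOnInterval ρ' ∧ ∃ M : ℕ, N ≤ M ∧ 2 ≤ M ∧ ρ' ≪ ρ ∧
      ρ' (primeNeighborhood M (salemScale α M))ᶜ = 0 ∧
      ∀ ξ : ℝ, ‖measureFourier ρ' ξ - measureFourier ρ ξ‖ ≤ δ * (1 + |ξ|) ^ (-γ) := by
  obtain ⟨W, hW0, hW⟩ := exists_tsum_translate_le
  obtain ⟨hfin, hsupp, B, hB⟩ := id hρ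
  have hB0 : 0 ≤ B := by
    have := (norm_nonneg _).trans (hB 0)
    simpa using this
  -- Chosen so that the perturbation `ε * B * W` is at most `δ`; `B + 1` avoids division by zero.
  have hε : 0 < δ / ((B + 1) * W) := by positivity
  obtain ⟨M, hM, hMN, hM2⟩ := ((eventually_primeTentCoeff_le hα0 hα1 hγ0 hγ hε).and
    ((Filter.eventually_ge_atTop N).and (Filter.eventually_ge_atTop 2))).exists
  set η := salemScale α M with hη
  have hη0 : 0 < η := salemScale_pos α hM2
  have hη1 : η ≤ 1 / 2 := salemScale_le_half hα0 hα1 hM2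
  have hFm := measurable_primeTent M η
  have hF0 := primeTent_nonneg M η
  have hF := hasSum_primeTent hη0 hη1 M
  obtain ⟨ha, hρ'⟩ := hρ.withDensity hFm hF0 (primeTentCoeff_le_mul_inv hM2 hη0) hF
  refine ⟨_, hρ', M, hMN, hM2, withDensity_absolutelyContinuous _ _, ?_, fun ξ => ?_⟩
  · have hm := (isClosed_primeNeighborhood M hη0.le).measurableSet.compl
    rw [withDensity_apply _ hm, setLIntegral_congr_fun (g := fun _ => 0) hm fun x hx => ?_,
      lintegral_zero]
    by_contra hne
    refine hx (mem_primeNeighborhood_of_primeTent_ne_zero fun h0 => hne ?_)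
    simp [h0]
  · refine (norm_measureFourier_withDensity_sub_le hB0 hB hW hFm hF0 ha hF
      (primeTentCoeff_zero hM2 η) hγ0 (by linarith) hε.le (fun k hk => ?_) ξ).trans ?_
    · rw [abs_of_nonneg (primeTentCoeff_nonneg M η k)]
      exact hM k hk
    · gcongr
      rw [div_mul_eq_mul_div, div_mul_eq_mul_div, div_le_iff₀ (by positivity)]
      have : 0 ≤ δ * W := by positivity
      nlinarith

/-- Each of at most `M` primes contributes about `p` intervals of length `2η / p`, so about `η ^ d *
M ^ (1 - d)`. With the chosen scale the exponent `2 - 2 * d / α` is negative exactly when `d > α`.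
-/
theorem sum_primesLE_cover_le {α d : ℝ} (hα0 : 0 < α) (hα1 : α < 1)
    (hd1 : d < 1) {M : ℕ} (hM : 2 ≤ M) :
    ∑ p ∈ Nat.primesLE M, ∑ _n ∈ Finset.range (2 * p + 1), (2 * salemScale α M / p) ^ d ≤
      6 * (M : ℝ) ^ (2 - 2 * d / α) := by
  have hη := salemScale_pos α hM
  set η := salemScale α M with hηdef
  have hM0 : (0 : ℝ) < M := by exact_mod_cast (by omega : 0 < M)
  have hterm : ∀ p ∈ Nat.primesLE M,
      ∑ _n ∈ Finset.range (2 * p + 1), (2 * η / p) ^ d ≤ 6 * η ^ d * (M : ℝ) ^ (1 - d) := by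
    intro p hp
    have hp1 : (1 : ℝ) ≤ p := by exact_mod_cast (Nat.prime_of_mem_primesLE hp).one_le
    have hp0 : (0 : ℝ) < p := by linarith
    have hpM : (p : ℝ) ≤ M := by exact_mod_cast Nat.le_of_mem_primesLE hp
    rw [Finset.sum_const, Finset.card_range, nsmul_eq_mul]
    push_cast
    have h2 : (2 : ℝ) ^ d ≤ 2 := by
      calc (2 : ℝ) ^ d ≤ 2 ^ (1 : ℝ) := Real.rpow_le_rpow_of_exponent_le (by norm_num) hd1.le
        _ = 2 := Real.rpow_one 2
    calc (2 * (p : ℝ) + 1) * (2 * η / p) ^ d ≤ (3 * p) * (2 * η / p) ^ d := by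
          gcongr
          linarith
      _ = 3 * 2 ^ d * η ^ d * (p : ℝ) ^ (1 - d) := by
          rw [Real.div_rpow (by positivity) hp0.le, Real.mul_rpow two_pos.le hη.le,
            Real.rpow_sub hp0, Real.rpow_one]
          ring
      _ ≤ 3 * 2 * η ^ d * (M : ℝ) ^ (1 - d) := by
          gcongr
      _ = _ := by ring
  have hcard : ((Nat.primesLE M).card : ℝ) ≤ M := by
    have h : Nat.primesLE M ⊆ Finset.Icc 1 M := fun p hp => Finset.mem_Icc.2
      ⟨(Nat.prime_of_mem_primesLE hp).one_le, Nat.le_of_mem_primesLE hp⟩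
    have := Finset.card_le_card h
    rw [Nat.card_Icc, Nat.add_sub_cancel] at this
    exact_mod_cast this
  calc _ ≤ ∑ _p ∈ Nat.primesLE M, 6 * η ^ d * (M : ℝ) ^ (1 - d) := Finset.sum_le_sum hterm
    _ = (Nat.primesLE M).card * (6 * η ^ d * (M : ℝ) ^ (1 - d)) := by
        rw [Finset.sum_const, nsmul_eq_mul]
    _ ≤ M * (6 * η ^ d * (M : ℝ) ^ (1 - d)) := by gcongr
    _ = 6 * ((M : ℝ) ^ (1 : ℝ) * (M : ℝ) ^ ((1 - 2 / α) * d) * (M : ℝ) ^ (1 - d)) := by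
        rw [hηdef, salemScale, ← Real.rpow_mul hM0.le, Real.rpow_one]
        ring
    _ = 6 * (M : ℝ) ^ (2 - 2 * d / α) := by
        rw [← Real.rpow_add hM0, ← Real.rpow_add hM0]
        congr 2
        ring

theorem dimH_le_of_subset_primeNeighborhood {α : ℝ} (hα0 : 0 < α) (hα1 : α < 1) {M : ℕ → ℕ}
    (hM : ∀ j, j ≤ M j) (hM2 : ∀ j, 2 ≤ M j) {C : Set ℝ} (hC : C ⊆ Icc 0 2)
    (hCM : ∀ j, C ⊆ primeNeighborhood (M j) (salemScale α (M j))) :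
    dimH C ≤ ENNReal.ofReal α := by
  by_contra! hlt
  obtain ⟨d, hd1, hd2⟩ := ENNReal.lt_iff_exists_nnreal_btwn.1
    (lt_min hlt (ENNReal.ofReal_lt_one.2 hα1))
  have hdα : α < d := by
    simpa using (ENNReal.ofReal_lt_iff_lt_toReal hα0.le ENNReal.coe_ne_top).1 hd1
  have hd1' : (d : ℝ) < 1 := by exact_mod_cast hd2.trans_le (min_le_right _ _)
  have htop := hausdorffMeasure_of_lt_dimH (hd2.trans_le (min_le_left _ _))
  set η : ℕ → ℝ := fun j => salemScale α (M j) with hη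
  have hη0 (j) : 0 < η j := salemScale_pos α (hM2 j)
  have hηh (j) : η j ≤ 1 / 2 := salemScale_le_half hα0 hα1 (hM2 j)
  have hMlim : Filter.Tendsto (fun j => (M j : ℝ)) Filter.atTop Filter.atTop :=
    tendsto_natCast_atTop_atTop.comp (Filter.tendsto_atTop_mono hM Filter.tendsto_id)
  have h2α : 2 < 2 / α := by rw [lt_div_iff₀ hα0]; linarith
  have hηlim : Filter.Tendsto η Filter.atTop (nhds 0) := by
    have := (tendsto_rpow_neg_atTop (by linarith : 0 < 2 / α - 1)).comp hMlim
    rw [neg_sub] at this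
    exact this
  let S : ℕ → Finset (Σ _ : ℕ, ℕ) := fun j =>
    (Nat.primesLE (M j)).sigma fun p => Finset.range (2 * p + 1)
  let t : ∀ j, S j → Set ℝ := fun j q =>
    Icc (((q.1.2 : ℝ) - η j) / q.1.1) (((q.1.2 : ℝ) + η j) / q.1.1)
  have hdiam (j) (q : S j) : Metric.ediam (t j q) = ENNReal.ofReal (2 * η j / q.1.1) := by
    simp only [t]
    rw [Real.ediam_Icc, ← sub_div]
    congr 2
    ring
  have hp1 (j) (q : S j) : (1 : ℝ) ≤ q.1.1 := by
    exact_mod_cast (Nat.prime_of_mem_primesLE (Finset.mem_sigma.1 q.2).1).one_le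
  have hle := Measure.hausdorffMeasure_le_liminf_sum (d : ℝ) C (l := Filter.atTop)
    (fun j => ENNReal.ofReal (2 * η j)) (by
      have := ENNReal.tendsto_ofReal (hηlim.const_mul 2)
      simpa using this) t
    (Filter.Eventually.of_forall fun j q => by
      rw [hdiam]
      exact ENNReal.ofReal_le_ofReal (div_le_self (by linarith [hη0 j]) (hp1 j q)))
    (Filter.Eventually.of_forall fun j x hx => by
      obtain ⟨p, hp, n, hn⟩ := hCM j hx
      have hp1 : (1 : ℝ) ≤ p := by exact_mod_cast (Nat.prime_of_mem_primesLE hp).one_le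
      have hp0 : (0 : ℝ) < p := by linarith
      obtain ⟨hx0, hx2⟩ := hC hx
      have hn' := abs_le.1 hn
      have hηj : salemScale α (M j) ≤ 1 / 2 := hηh j
      have hn0 : 0 ≤ n := by
        by_contra! hneg
        have h1 : (n : ℝ) ≤ -1 := by exact_mod_cast (by omega : n ≤ -1)
        nlinarith
      obtain ⟨n, rfl⟩ := Int.eq_ofNat_of_zero_le hn0
      have hn2 : n < 2 * p + 1 := by
        by_contra! hge
        have h1 : ((2 * p + 1 : ℕ) : ℝ) ≤ n := by exact_mod_cast hge
        push_cast at h1 hn'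
        nlinarith
      -- For `x ∈ [0, 2]` and precision at most `1 / 2`, only the numerators `0, …, 2p` occur.
      refine mem_iUnion.2 ⟨⟨⟨p, n⟩, Finset.mem_sigma.2 ⟨hp, Finset.mem_range.2 hn2⟩⟩, ?_⟩
      push_cast at hn'
      refine ⟨?_, ?_⟩
      · rw [div_le_iff₀ hp0]
        linarith [hn'.1, show η j = salemScale α (M j) from rfl]
      · rw [le_div_iff₀ hp0]
        linarith [hn'.2, show η j = salemScale α (M j) from rfl])
  have hsum (j) : ∑ q, Metric.ediam (t j q) ^ (d : ℝ) ≤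
      ENNReal.ofReal (6 * (M j : ℝ) ^ (2 - 2 * d / α)) := by
    have h1 : ∑ q, Metric.ediam (t j q) ^ (d : ℝ) =
        ∑ q : S j, ENNReal.ofReal ((2 * η j / q.1.1) ^ (d : ℝ)) := by
      refine Finset.sum_congr rfl fun q _ => ?_
      rw [hdiam, ENNReal.ofReal_rpow_of_nonneg (by have := hη0 j; positivity) d.coe_nonneg]
    rw [h1, Finset.sum_coe_sort (S j) fun q => ENNReal.ofReal ((2 * η j / q.1) ^ (d : ℝ)),
      ← ENNReal.ofReal_sum_of_nonneg fun q _ => by have := hη0 j; positivity]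
    refine ENNReal.ofReal_le_ofReal ?_
    rw [Finset.sum_sigma]
    exact sum_primesLE_cover_le hα0 hα1 hd1' (hM2 j)
  have hlim : Filter.Tendsto (fun j => ENNReal.ofReal (6 * (M j : ℝ) ^ (2 - 2 * d / α)))
      Filter.atTop (nhds 0) := by
    have hpos : 0 < 2 * d / α - 2 := by
      rw [sub_pos, lt_div_iff₀ hα0]
      linarith
    have := ENNReal.tendsto_ofReal
      (((tendsto_rpow_neg_atTop hpos).comp hMlim).const_mul 6)
    simpa only [neg_sub, mul_zero, ENNReal.ofReal_zero, Function.comp_def] using this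
  have hzero : μH[d] C ≤ 0 := by
    refine hle.trans (le_of_le_of_eq (Filter.liminf_le_liminf ?_) hlim.liminf_eq)
    exact Filter.Eventually.of_forall hsum
  rw [htop] at hzero
  simp at hzero

/-- Weak limits along an ultrafilter of measures on a compact interval, with convergence of the
Fourier transforms. -/
theorem exists_weakLimit {K : Set ℝ} (hK : IsCompact K) {ρ : ℕ → Measure ℝ}
    [∀ j, IsFiniteMeasure (ρ j)] {c : ℝ≥0} (hc : ∀ j, ρ j univ ≤ c) (hρ : ∀ j, ρ j Kᶜ = 0) :
    ∃ (L : Ultrafilter ℕ) (ν : Measure ℝ), (L : Filter ℕ) ≤ Filter.atTop ∧ IsFiniteMeasure ν ∧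
      (∀ ξ, Filter.Tendsto (fun j => measureFourier (ρ j) ξ) L (nhds (measureFourier ν ξ))) ∧
      ∀ E : Set ℝ, IsCompact E → (∀ᶠ j in Filter.atTop, ρ j Eᶜ = 0) → ν Eᶜ = 0 := by
  -- The dummy quantifier over `ℕ` puts a single support condition into the shape of the tightness
  -- criterion, with constant sequences.
  let X : Set ℝ → Set (FiniteMeasure ℝ) := fun E =>
    {μ | μ.mass ≤ c ∧ ∀ _ : ℕ, μ Eᶜ ≤ (0 : ℝ≥0)}
  have hX (E : Set ℝ) (hE : IsCompact E) : IsCompact (X E) :=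
    isCompact_setOfPred_finiteMeasure_mass_le_compl_isCompact_le (u := fun _ => 0)
      (K := fun _ => E) c tendsto_const_nhds (fun _ => hE) (Or.inl inferInstance)
  let σ : ℕ → FiniteMeasure ℝ := fun j => ⟨ρ j, inferInstance⟩
  have hσ (E : Set ℝ) (j : ℕ) (h : ρ j Eᶜ = 0) : σ j ∈ X E := by
    refine ⟨?_, fun _ => ?_⟩
    · rw [← ENNReal.coe_le_coe, FiniteMeasure.ennreal_mass]
      exact hc j
    · rw [← ENNReal.coe_le_coe, FiniteMeasure.ennreal_coeFn_eq_coeFn_toMeasure]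
      exact h.le
  let L : Ultrafilter ℕ := Ultrafilter.of Filter.atTop
  have hL : (L : Filter ℕ) ≤ Filter.atTop := Ultrafilter.of_le _
  obtain ⟨ν, -, hν⟩ := (hX K hK).ultrafilter_le_nhds (L.map σ) (by
    rw [Filter.le_principal_iff]
    exact Filter.mem_map.2 (Filter.univ_mem' fun j => hσ K j (hρ j)))
  have hlim : Filter.Tendsto σ L (nhds ν) := hν
  refine ⟨L, ν, hL, inferInstance, fun ξ => ?_, fun E hE h => ?_⟩
  · let f : BoundedContinuousFunction ℝ ℂ := BoundedContinuousFunction.ofNormedAddCommGroup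
      (fun x : ℝ => Complex.exp (-2 * Real.pi * Complex.I * x * ξ)) (by fun_prop) 1
      fun x => (norm_exp_measureFourier_kernel x ξ).le
    exact (FiniteMeasure.tendsto_iff_forall_integral_rclike_tendsto ℂ).1 hlim f
  · have hmem : ν ∈ X E := (hX E hE).isClosed.mem_of_tendsto hlim
      ((h.filter_mono hL).mono fun j hj => hσ E j hj)
    have h0 := hmem.2 0
    rw [← ENNReal.coe_le_coe, FiniteMeasure.ennreal_coeFn_eq_coeFn_toMeasure] at h0
    simpa using h0

/-- Summing the increments of the Fourier transforms along the construction. -/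
theorem norm_sub_le_of_norm_succ_sub_le {E : Type*} [NormedAddCommGroup E] {u : ℕ → E} {c : ℝ}
    {j₀ : ℕ} (hc : 0 ≤ c)
    (h : ∀ j, j₀ ≤ j → ‖u (j + 1) - u j‖ ≤ (1 / 2) ^ (j + 2) * c) {i : ℕ} (hi : j₀ ≤ i) :
    ‖u i - u j₀‖ ≤ 1 / 2 * c := by
  have key : ‖u i - u j₀‖ ≤ (1 / 2 - (1 / 2) ^ (i + 1)) * c := by
    induction i, hi using Nat.le_induction with
    | base =>
      rw [sub_self, norm_zero]
      refine mul_nonneg (sub_nonneg.2 ?_) hc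
      exact pow_le_of_le_one (by norm_num) (by norm_num) (by omega)
    | succ i hi ih =>
      calc ‖u (i + 1) - u j₀‖ = ‖(u (i + 1) - u i) + (u i - u j₀)‖ := by congr 1; abel
        _ ≤ (1 / 2) ^ (i + 2) * c + (1 / 2 - (1 / 2) ^ (i + 1)) * c :=
            (norm_add_le _ _).trans (add_le_add (h i hi) ih)
        _ = _ := by ring
  refine key.trans ?_
  have : (0 : ℝ) < (1 / 2) ^ (i + 1) := by positivity
  gcongr
  linarith

theorem measureFourier_zero (μ : Measure ℝ) : measureFourier μ 0 = (μ.real univ : ℂ) := by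
  simp [measureFourier]

/-- Salem sets of every dimension `0 < α < 1`. -/
theorem exists_salem_measure {α : ℝ} (hα0 : 0 < α) (hα1 : α < 1) :
    ∃ C : Set ℝ, IsCompact C ∧ C ⊆ Icc 0 2 ∧ dimH C ≤ ENNReal.ofReal α ∧
      ∃ μ ∈ compactlySupportedMeasures C, ∀ γ : ℝ, 0 ≤ γ → γ < α / 2 →
        HasFourierDecay μ (2 * γ) := by
  -- The exponents increase to `α / 2` without reaching it. A given `γ < α / 2` is therefore
  -- respected from some stage on, and the measure at that stage is smooth anyway.
  set γ' : ℕ → ℝ := fun j => α / 2 * (1 - 1 / ((j : ℝ) + 1)) with hγ'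
  have hγ'0 (j) : 0 ≤ γ' j := by
    have : 1 / ((j : ℝ) + 1) ≤ 1 := by
      rw [div_le_one (by positivity)]
      linarith [Nat.cast_nonneg (α := ℝ) j]
    have := sub_nonneg.2 this
    positivity
  have hγ'1 (j) : γ' j < α / 2 := by
    have : 0 < 1 / ((j : ℝ) + 1) := by positivity
    simp only [hγ']
    nlinarith
  have hstep (j : ℕ) (ρ : {ρ // IsSmoothOnInterval ρ}) :=
    ρ.2.exists_step hα0 hα1 (hγ'0 j) (hγ'1 j) (by positivity : (0 : ℝ) < (1 / 2) ^ (j + 2)) j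
  choose next hnext Mf hMf hMf2 hac hnull hdiff using hstep
  obtain ⟨ρ₀, hρ₀, hρ₀1⟩ := exists_isSmoothOnInterval
  let r : ℕ → {ρ // IsSmoothOnInterval ρ} := fun j =>
    Nat.rec ⟨ρ₀, hρ₀⟩ (fun j ρ => ⟨next j ρ, hnext j ρ⟩) j
  have hr0 : (r 0).1 = ρ₀ := rfl
  have hrS (j) : (r (j + 1)).1 = next j (r j) := rfl
  let M : ℕ → ℕ := fun j => Mf j (r j)
  have hfin (j) : IsFiniteMeasure (r j).1 := (r j).2.1
  -- Absolute continuity passes every earlier sieve condition on to all later measures.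
  have hrac (i j) (hij : i ≤ j) : (r j).1 ≪ (r i).1 := by
    induction j, hij using Nat.le_induction with
    | base => exact Measure.AbsolutelyContinuous.rfl
    | succ j _ ih =>
      rw [hrS]
      exact (hac j (r j)).trans ih
  have hrnull (j i) (hij : j < i) :
      (r i).1 (primeNeighborhood (M j) (salemScale α (M j)))ᶜ = 0 :=
    hrac (j + 1) i hij (hnull j (r j))
  have hdiff' (j) (ξ : ℝ) : ‖measureFourier (r (j + 1)).1 ξ -
      measureFourier (r j).1 ξ‖ ≤ (1 / 2) ^ (j + 2) * (1 + |ξ|) ^ (-γ' j) :=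
    hdiff j (r j) ξ
  -- At frequency zero the increments `(1/2) ^ (j + 2)` add up to at most `1 / 2`, so the masses
  -- stay in `[1/2, 3/2]` and the weak limit is non-zero.
  have hmass (i) : |(r i).1.real univ - 1| ≤ 1 / 2 := by
    have h := norm_sub_le_of_norm_succ_sub_le (u := fun j => measureFourier (r j).1 0)
      (c := 1) (j₀ := 0) zero_le_one (fun j _ => by simpa using hdiff' j 0) (Nat.zero_le i)
    simp only [measureFourier_zero, hr0] at h
    rw [← Complex.ofReal_sub, Complex.norm_real, Real.norm_eq_abs, mul_one,
      show ρ₀.real univ = 1 by simp [Measure.real, hρ₀1]] at h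
    exact h
  obtain ⟨L, ν, hL, hνfin, hνF, hνnull⟩ := exists_weakLimit (K := Icc (0 : ℝ) 2) isCompact_Icc
    (ρ := fun j => (r j).1) (c := 2) (fun j => by
      rw [← ofReal_measureReal, ENNReal.ofReal_le_iff_le_toReal (by simp)]
      have := (abs_le.1 (hmass j)).2
      simp only [ENNReal.coe_ofNat, ENNReal.toReal_ofNat]
      linarith) (fun j => (r j).2.2.1)
  have hcl (j) : IsClosed (primeNeighborhood (M j) (salemScale α (M j))) :=
    isClosed_primeNeighborhood _ (salemScale_pos α (hMf2 j (r j))).le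
  set C : Set ℝ := Icc 0 2 ∩ ⋂ j, primeNeighborhood (M j) (salemScale α (M j)) with hC
  have hCc : IsCompact C := isCompact_Icc.inter_right (isClosed_iInter hcl)
  have hνC : ν Cᶜ = 0 := by
    have h1 (j) : ν (Icc 0 2 ∩ primeNeighborhood (M j) (salemScale α (M j)))ᶜ = 0 := by
      refine hνnull _ (isCompact_Icc.inter_right (hcl j)) ?_
      filter_upwards [Filter.eventually_gt_atTop j] with i hi
      rw [compl_inter]
      exact measure_union_null (r i).2.2.1 (hrnull j i hi)
    refine measure_mono_null (fun x hx => ?_) (measure_iUnion_null h1)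
    rw [hC, inter_iInter, compl_iInter] at hx
    exact hx
  have hsupp : ν.support ⊆ C := Measure.support_subset_of_isClosed hCc.isClosed hνC
  have hν0 : ν ≠ 0 := by
    rintro rfl
    have h1 := hνF 0
    have h2 : ∀ j, (1 / 2 : ℝ) ≤ ‖measureFourier (r j).1 0‖ := fun j => by
      rw [measureFourier_zero, Complex.norm_real, Real.norm_of_nonneg measureReal_nonneg]
      have := (abs_le.1 (hmass j)).1
      linarith
    have h3 := ge_of_tendsto' h1.norm h2
    rw [measureFourier_zero] at h3
    simp at h3
    linarith
  refine ⟨C, hCc, inter_subset_left, ?_, ν, ⟨hνfin, hν0, hCc.of_isClosed_subset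
    Measure.isClosed_support hsupp, hsupp⟩, fun γ hγ0 hγ => ?_⟩
  · exact dimH_le_of_subset_primeNeighborhood hα0 hα1 (fun j => hMf j (r j))
      (fun j => hMf2 j (r j)) inter_subset_left
      (fun j => inter_subset_right.trans (iInter_subset _ j))
  · have hγlim : Filter.Tendsto γ' Filter.atTop (nhds (α / 2)) := by
      have := ((tendsto_one_div_add_atTop_nhds_zero_nat (𝕜 := ℝ)).const_sub 1).const_mul (α / 2)
      rwa [sub_zero, mul_one] at this
    obtain ⟨j₀, hj₀⟩ := Filter.eventually_atTop.1 (hγlim.eventually_const_le hγ)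
    obtain ⟨B, hB⟩ := (r j₀).2.2.2
    have hB0 : 0 ≤ B := by
      have := (norm_nonneg _).trans (hB 0)
      simpa using this
    have hbound (ξ : ℝ) (i : ℕ) (hi : j₀ ≤ i) :
        ‖measureFourier (r i).1 ξ‖ ≤ (B + 1) * (1 + |ξ|) ^ (-γ) := by
      have h1 : (1 : ℝ) ≤ 1 + |ξ| := by linarith [abs_nonneg ξ]
      have h2 := norm_sub_le_of_norm_succ_sub_le
        (u := fun j => measureFourier (r j).1 ξ) (c := (1 + |ξ|) ^ (-γ)) (j₀ := j₀)
        (by positivity) (fun j hj => (hdiff' j ξ).trans (by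
          gcongr
          exact hj₀ j hj)) hi
      have h3 : ‖measureFourier (r j₀).1 ξ‖ ≤ B * (1 + |ξ|) ^ (-γ) := by
        refine (hB ξ).trans ?_
        gcongr
        rw [← Real.rpow_natCast, ← Real.rpow_neg (by positivity)]
        refine Real.rpow_le_rpow_of_exponent_le h1 ?_
        push_cast
        linarith
      calc ‖measureFourier (r i).1 ξ‖ = ‖(measureFourier (r i).1 ξ -
            measureFourier (r j₀).1 ξ) + measureFourier (r j₀).1 ξ‖ := by
            rw [sub_add_cancel]
        _ ≤ 1 / 2 * (1 + |ξ|) ^ (-γ) + B * (1 + |ξ|) ^ (-γ) :=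
            (norm_add_le _ _).trans (add_le_add h2 h3)
        _ ≤ _ := by
            have : 0 ≤ (1 + |ξ|) ^ (-γ) := by positivity
            linarith
    refine ⟨(B + 1) ^ 2, ?_⟩
    rintro _ ⟨ξ, rfl⟩
    have h1 : ‖measureFourier ν ξ‖ ≤ (B + 1) * (1 + |ξ|) ^ (-γ) :=
      le_of_tendsto (hνF ξ).norm
        (((Filter.eventually_ge_atTop j₀).filter_mono hL).mono fun i hi => hbound ξ i hi)
    have h2 : |ξ| ^ (2 * γ) ≤ ((1 + |ξ|) ^ γ) ^ 2 := by
      rw [← Real.rpow_natCast, ← Real.rpow_mul (by positivity), mul_comm γ]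
      push_cast
      gcongr
      linarith
    calc ‖measureFourier ν ξ‖ ^ 2 * |ξ| ^ (2 * γ)
        ≤ ((B + 1) * (1 + |ξ|) ^ (-γ)) ^ 2 * ((1 + |ξ|) ^ γ) ^ 2 := by gcongr
      _ = (B + 1) ^ 2 * ((1 + |ξ|) ^ (-γ) * (1 + |ξ|) ^ γ) ^ 2 := by ring
      _ = (B + 1) ^ 2 := by
          rw [← Real.rpow_add (by positivity), neg_add_cancel, Real.rpow_zero]
          ring

theorem ofReal_le_fourierDim {A : Set ℝ} {α : ℝ} (hα1 : α ≤ 1) {μ : Measure ℝ}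
    (hμ : μ ∈ compactlySupportedMeasures A)
    (h : ∀ s : ℝ, 0 ≤ s → s < α → HasFourierDecay μ s) : ENNReal.ofReal α ≤ fourierDim A := by
  refine ENNReal.le_of_forall_nnreal_lt fun t ht => ?_
  have htα : (t : ℝ) < α := by
    rwa [← ENNReal.ofReal_coe_nnreal, ENNReal.ofReal_lt_ofReal_iff_of_nonneg t.coe_nonneg] at ht
  exact le_iSup₂_of_le (f := fun (s : ℝ≥0) (_ : s ≤ 1 ∧
    ∃ μ ∈ compactlySupportedMeasures A, HasFourierDecay μ s) => (s : ℝ≥0∞)) t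
    ⟨by exact_mod_cast (htα.le.trans hα1), μ, hμ, h t t.coe_nonneg htα⟩ le_rfl

theorem mem_compactlySupportedMeasures {A : Set ℝ} (hA : IsCompact A) {μ : Measure ℝ}
    [IsFiniteMeasure μ] (h0 : μ ≠ 0) (h : μ Aᶜ = 0) : μ ∈ compactlySupportedMeasures A := by
  have hs : μ.support ⊆ A := Measure.support_subset_of_isClosed hA.isClosed h
  exact ⟨inferInstance, h0, hA.of_isClosed_subset Measure.isClosed_support hs, hs⟩

/-- Salem sets of every dimension in `[0, 1]`. -/
theorem exists_salem {α : ℝ} (hα : α ∈ Icc (0 : ℝ) 1) :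
    ∃ C : Set ℝ, IsCompact C ∧ C ⊆ Icc 0 2 ∧ C.Nonempty ∧ dimH C ≤ ENNReal.ofReal α ∧
      ENNReal.ofReal α ≤ fourierDim C := by
  -- The sieve needs `0 < α < 1`; the endpoints are served by a point and by the whole interval.
  rcases hα.1.eq_or_lt with rfl | hα0
  · exact ⟨{0}, isCompact_singleton, by simp, singleton_nonempty 0, by simp, by simp⟩
  rcases hα.2.eq_or_lt with rfl | hα1
  · obtain ⟨ρ, ⟨hf, hρ, B, hB⟩, hρ1⟩ := exists_isSmoothOnInterval
    have h0 : ρ ≠ 0 := by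
      rintro rfl
      simp at hρ1
    refine ⟨Icc 0 2, isCompact_Icc, subset_rfl, nonempty_Icc.2 (by norm_num), ?_,
      ofReal_le_fourierDim le_rfl (mem_compactlySupportedMeasures isCompact_Icc h0 hρ)
        fun s hs0 hs1 => ⟨B ^ 2, ?_⟩⟩
    · rw [ENNReal.ofReal_one, ← Real.dimH_univ]
      exact dimH_mono (subset_univ _)
    · rintro _ ⟨ξ, rfl⟩
      have h1 : (1 : ℝ) ≤ 1 + |ξ| := by linarith [abs_nonneg ξ]
      have hB0 : 0 ≤ B := by simpa using (norm_nonneg _).trans (hB 0)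
      have h2 : |ξ| ^ s ≤ (1 + |ξ|) ^ 4 := by
        calc |ξ| ^ s ≤ (1 + |ξ|) ^ s := by gcongr; linarith
          _ ≤ (1 + |ξ|) ^ (4 : ℝ) := Real.rpow_le_rpow_of_exponent_le h1 (by linarith)
          _ = _ := by rw [← Real.rpow_natCast]; norm_num
      calc ‖measureFourier ρ ξ‖ ^ 2 * |ξ| ^ s
          ≤ (B * ((1 + |ξ|) ^ 2)⁻¹) ^ 2 * (1 + |ξ|) ^ 4 := by
            gcongr
            exact hB ξ
        _ = B ^ 2 := by field_simp
  · obtain ⟨C, hC, hC2, hd, μ, hμ, h⟩ := exists_salem_measure hα0 hα1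
    refine ⟨C, hC, hC2, ?_, hd, ofReal_le_fourierDim hα.2 hμ fun s hs0 hs => ?_⟩
    · have := hμ.2.1
      have hne : μ.support.Nonempty := by
        rw [Measure.nonempty_support_iff]
        exact this
      exact hne.mono hμ.2.2.2
    · have := h (s / 2) (by linarith) (by linarith)
      rwa [mul_div_cancel₀ s two_ne_zero] at this

/-! ### Affine images and the conclusion. -/

theorem norm_measureFourier_map_affine (μ : Measure ℝ) (a b ξ : ℝ) :
    ‖measureFourier (μ.map fun c => a + b * c) ξ‖ = ‖measureFourier μ (b * ξ)‖ := by
  have h : measureFourier (μ.map fun c => a + b * c) ξ =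
      Complex.exp (-2 * Real.pi * Complex.I * a * ξ) * measureFourier μ (b * ξ) := by
    rw [measureFourier, measureFourier, integral_map (by fun_prop) (by fun_prop),
      ← integral_const_mul]
    congr 1 with c
    rw [← Complex.exp_add]
    congr 1
    push_cast
    ring
  rw [h, norm_mul, norm_exp_measureFourier_kernel, one_mul]

/-- Translation only changes the phase of the transform, and dilation by `b` rescales the frequency,
which costs the factor `b ^ (-s)` in the bound. -/
theorem fourierDim_le_fourierDim_image_affine (A : Set ℝ) (a : ℝ) {b : ℝ} (hb : 0 < b) :
    fourierDim A ≤ fourierDim ((fun c => a + b * c) '' A) := by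
  refine iSup₂_mono' fun s hs => ⟨s, ⟨hs.1, ?_⟩, le_rfl⟩
  obtain ⟨-, μ, ⟨hf, h0, hc, hA⟩, B, hB⟩ := hs
  have hm : Measurable fun c : ℝ => a + b * c := by fun_prop
  have hK : IsCompact ((fun c => a + b * c) '' μ.support) := hc.image (by fun_prop)
  have hnull : (μ.map fun c => a + b * c) ((fun c => a + b * c) '' μ.support)ᶜ = 0 := by
    rw [Measure.map_apply hm hK.measurableSet.compl]
    refine measure_mono_null (fun x hx hxs => hx (mem_image_of_mem _ hxs))
      Measure.measure_compl_support
  have hmem := mem_compactlySupportedMeasures hK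
    ((Measure.map_ne_zero_iff hm.aemeasurable).2 h0) hnull
  refine ⟨_, ⟨hmem.1, hmem.2.1, hmem.2.2.1, hmem.2.2.2.trans (image_mono hA)⟩,
    B * (b ^ (s : ℝ))⁻¹, ?_⟩
  rintro _ ⟨ξ, rfl⟩
  have h1 := hB ⟨b * ξ, rfl⟩
  simp only [abs_mul, abs_of_pos hb, Real.mul_rpow hb.le (abs_nonneg ξ)] at h1
  rw [le_mul_inv_iff₀ (by positivity)]
  simp only [norm_measureFourier_map_affine]
  linarith

theorem dimH_image_affine_le (A : Set ℝ) (a b : ℝ) :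
    dimH ((fun c => a + b * c) '' A) ≤ dimH A := by
  have h : LipschitzWith ‖b‖₊ fun c : ℝ => a + b * c :=
    LipschitzWith.of_dist_le_mul fun x y => by
      rw [Real.dist_eq, Real.dist_eq, coe_nnnorm, Real.norm_eq_abs, ← abs_mul]
      exact le_of_eq (congrArg _ (by ring))
  exact h.dimH_image_le A

/-- Lowers one summand while keeping the strict inequality. A vanishing summand has nothing strictly
below it, hence the alternative `s = 0`. -/
theorem exists_nnreal_lt_add {x a b : ℝ≥0∞} (h : x < a + b) :
    ∃ s : ℝ≥0, (s = 0 ∨ s < a) ∧ x < s + b := by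
  rcases eq_or_ne a 0 with rfl | ha
  · exact ⟨0, Or.inl rfl, by simpa using h⟩
  rcases eq_or_ne b 0 with rfl | hb
  · rw [add_zero] at h
    obtain ⟨s, hs, hsa⟩ := ENNReal.lt_iff_exists_nnreal_btwn.1 h
    exact ⟨s, Or.inr hsa, by simpa using hs⟩
  · obtain ⟨y, hy, z, hz, hyz⟩ := ENNReal.exists_lt_add_of_lt_add h ha hb
    lift y to ℝ≥0 using hy.ne_top
    exact ⟨y, Or.inr hy, hyz.trans_le (by gcongr)⟩

theorem mainTheorem5 (Y Z : Set ℝ) (hY : IsCompact Y) (hZ : IsCompact Z)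
    (hZne : Z.Nonempty) (hY0 : ∃ y ∈ Y, y ≠ 0)
    (hpos : 0 < fourierDim Y + dimH Z) (α : ℝ) (hα : α ∈ Icc (0 : ℝ) 1)
    (hdim : ENNReal.ofReal (1 - α) < fourierDim Y + dimH Z) :
    ∃ R : Set ℝ, IsCompact R ∧ R ⊆ Ioi 0 ∧
      dimH R = ENNReal.ofReal α ∧ fourierDim R = ENNReal.ofReal α ∧
      0 < volume (R * Y + Z) := by
  obtain ⟨C, hC, hC2, hCne, hCd, hCF⟩ := exists_salem hα
  have hsum : 1 < fourierDim C + (fourierDim Y + dimH Z) := by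
    calc (1 : ℝ≥0∞) = ENNReal.ofReal α + ENNReal.ofReal (1 - α) := by
          rw [← ENNReal.ofReal_add hα.1 (sub_nonneg.2 hα.2), add_sub_cancel, ENNReal.ofReal_one]
      _ < ENNReal.ofReal α + (fourierDim Y + dimH Z) :=
          ENNReal.add_lt_add_left ENNReal.ofReal_ne_top hdim
      _ ≤ _ := by gcongr
  obtain ⟨s₁, hs₁, hsum⟩ := exists_nnreal_lt_add hsum
  rw [add_left_comm] at hsum
  obtain ⟨s₂, hs₂, hsum⟩ := exists_nnreal_lt_add hsum
  rw [← add_assoc, add_comm] at hsum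
  obtain ⟨s₃, hs₃, hsum⟩ := exists_nnreal_lt_add hsum
  have hs : 1 < (s₁ : ℝ) + s₂ + s₃ := by
    have h : 1 < s₃ + (s₂ + s₁) := by exact_mod_cast hsum
    have h' : (1 : ℝ) < s₃ + (s₂ + s₁) := by exact_mod_cast h
    linarith
  have h₁ : HasCorrelation C s₁ := by
    rcases hs₁ with rfl | h
    · exact hasCorrelation_zero hCne
    · exact hasCorrelation_of_lt_fourierDim h
  have h₃ : HasCorrelation Z s₃ := by
    rcases eq_or_ne s₃ 0 with rfl | h0
    · exact hasCorrelation_zero hZne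
    · exact hasCorrelation_of_lt_dimH hZ.isClosed (pos_iff_ne_zero.2 h0) (hs₃.resolve_left h0)
  -- A positive exponent excludes an atom at `0`, so mass survives away from it; for exponent zero
  -- the non-zero point of `Y` is used.
  have h₂ : ∃ m : ℝ, 0 < m ∧ HasCorrelation (Y ∩ {y | m ≤ |y|}) s₂ := by
    rcases eq_or_ne s₂ 0 with rfl | h0
    · obtain ⟨y, hy, hy0⟩ := hY0
      exact ⟨|y|, abs_pos.2 hy0, hasCorrelation_zero ⟨y, hy, le_refl |y|⟩⟩
    · exact (hasCorrelation_of_lt_fourierDim (hs₂.resolve_left h0)).exists_away_from_zero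
        (by exact_mod_cast pos_iff_ne_zero.2 h0)
  obtain ⟨m, hm, h₂⟩ := h₂
  have hB : IsCompact (Y ∩ {y | m ≤ |y|}) :=
    hY.inter_right (isClosed_le continuous_const continuous_abs)
  obtain ⟨a, ha, b, hb, hvol⟩ :=
    exists_affine_volume_pos hC hB hZ hm (fun y hy => hy.2) h₁ h₂ h₃ hs
  have hb0 : 0 < b := zero_lt_one.trans_le hb.1
  have hRd := (dimH_image_affine_le C a b).trans hCd
  have hRF := hCF.trans (fourierDim_le_fourierDim_image_affine C a hb0)
  have hle := fourierDim_le_dimH ((fun c => a + b * c) '' C)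
  refine ⟨(fun c => a + b * c) '' C, hC.image (by fun_prop), ?_, hRd.antisymm (hRF.trans hle),
    (hle.trans hRd).antisymm hRF, hvol.trans_le (measure_mono ?_)⟩
  · rintro _ ⟨c, hc, rfl⟩
    have := mul_nonneg hb0.le (hC2 hc).1
    simp only [mem_Ioi]
    linarith [ha.1]
  · exact add_subset_add_right (mul_subset_mul_left inter_subset_left)
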